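/- Let $n\ge 1$, $m\ge 0$ and let $r_0,\dots,r_n$ be non-negative integers with $r_n=0$, $r_{n-1}=m$ and $r_\ell\ge 2r_{\ell+1}$ for $\ell=0,\dots,n-2$. Let $k\ge 2r_0+1$. Notation. For a nondegenerate $n$-simplex $T\subset\mathbb R^n$, let $\Delta_\ell(T)$ be the set of its $\ell$-dimensional sub-simplices, identified with their vertex sets, and let $\lambda_v$ be the barycentric coordinate of the vertex $v$. Let $\mathbb T^n_k(T)$ be the set of multi-indices $\alpha=(\alpha_v)$ of non-negative integers, indexed by the vertices $v$ of $T$, with $|\alpha|=k$; put $\lambda^\alpha=\prod_v\lambda_v^{\alpha_v}$, and let $\alpha_f$ be the restriction of $\alpha$ to the vertices of $f$. For $f\in\Delta_\ell(T)$ put $D(f,\rho)=\{\alpha\in\mathbb T^n_k(T):\sum_{v\notin f}\alpha_v\le \rho\}$ and $$S_\ell(f)=D(f,r_\ell)\setminus\bigcup_{i=0}^{\ell-1}\ \bigcup_{e\in\Delta_i(f)}D(e,r_i),$$ so that $S_0(v)=D(v,r_0)$ and $S_n(T)=\mathbb T^n_k(T)\setminus\bigcup_{i<n}\bigcup_{e\in\Delta_i(T)}D(e,r_i)$.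 Let $\mathbb P_k(T)$ be the space of real polynomials of degree at most $k$ on $T$, and $\mathbb P_k(S)=\operatorname{span}\{\lambda^\alpha:\alpha\in S\}$. For each sub-simplex $f$ of dimension $1\le\ell\le n-1$ let $n_f=(n_f^1,\dots,n_f^{n-\ell})$ be any basis of the normal plane of $f$ (the orthogonal complement of its directions). Then the following hold. 1. (Decomposition.) For every nondegenerate $n$-simplex $T$, the lattice $\mathbb T^n_k(T)$ is the disjoint union of the sets $S_\ell(f)$, $f\in\Delta_\ell(T)$, $\ell=0,\dots,n$, and consequently $$\mathbb P_k(T)=\bigoplus_{\ell=0}^n\bigoplus_{f\in\Delta_\ell(T)}\mathbb P_k(S_\ell(f)).$$ 2. (Unisolvence.) For every nondegenerate $n$-simplex $T$, the following degrees of freedom (DoFs) are unisolvent for $\mathbb P_k(T)$, that is, the map sending $u\in\mathbb P_k(T)$ to the family of its DoF values is a linear isomorphism from $\mathbb P_k(T)$ onto the space of all real families indexed by the DoFs: - (a) $D^\alpha u(v)$ for vertices $v$ of $T$ and $\alpha\in\mathbb N^n$ with $|\alpha|\le r_0$; - (b) $\displaystyle\int_f\frac{\partial^\beta u}{\partial n_f^\beta}\,\lambda_f^{\alpha_f}\,ds$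 for $f\in\Delta_\ell(T)$, $1\le\ell\le n-1$, $0\le s\le r_\ell$, $\beta\in\mathbb N^{n-\ell}$ with $|\beta|=s$, and all distinct restrictions $\alpha_f$ with $\alpha\in S_\ell(f)$, $|\alpha_f|=k-s$; - (c) $\displaystyle\int_T u\,\lambda^\alpha\,dx$ for $\alpha\in S_n(T)$. 3. (Global space.) Let $\mathcal T_h$ be a finite conforming simplicial mesh of an open set $\Omega\subset\mathbb R^n$: the cells $T\in\mathcal T_h$ are nondegenerate $n$-simplices, $\overline\Omega=\bigcup_{T\in\mathcal T_h}T$, and any two cells meet in the (possibly empty) simplex spanned by their common vertices. Let the frames $n_f$ depend only on $f$, not on the cell containing it, and call DoFs single-valued if each DoF of type (a) or (b) has the same value computed from every cell containing the vertex $v$ or the sub-simplex $f$. Let $V_h$ be the space of functions $u$ on $\overline\Omega$ such that $u\in C^m(\Omega)$, $u|_T\in\mathbb P_k(T)$ for all $T\in\mathcal T_h$, and the DoFs of $u$ are single-valued. - Conformity: if $u_T\in\mathbb P_k(T)$, $T\in\mathcal T_h$, is any family of polynomials whose DoFs (a), (b) are single-valued, then there is exactly one $u\in V_h$ with $u|_T=u_T$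 for all $T\in\mathcal T_h$; in particular, this $u$ is in $C^m(\Omega)$. - The set $V_h$ is a linear space, and the DoFs (a)–(c) of the mesh, those of a shared vertex or sub-simplex being counted once, are unisolvent for it: the map sending $u\in V_h$ to the family of its DoF values is a linear isomorphism from $V_h$ onto the space of all real families indexed by the DoFs of the mesh. -/

import Mathlib

namespace SmoothFE

open scoped Classical in
/-- Distance `|α_{f*}|` of a lattice node `α` of the simplex with vertex set `T` to its
sub-simplex `f`. Multi-indices are indexed by vertices, and a multi-index on `f` is identified with
its extension by zero. -/
noncomputable def dist {V : Type*} (T f : Finset V) (α : V →₀ ℕ) : ℕ := ∑ v ∈ T \ f, α v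

/-- The simplicial lattice of degree `k` on the simplex with vertex set `T`. -/
def lattice {V : Type*} (k : ℕ) (T : Finset V) : Set (V →₀ ℕ) :=
  {α | α.support ⊆ T ∧ ∑ v ∈ T, α v = k}

/-- The lattice tube `D(f, ρ)`: the nodes at distance at most `ρ` from `f`. -/
def tube {V : Type*} (k : ℕ) (T f : Finset V) (ρ : ℕ) : Set (V →₀ ℕ) :=
  {α | α ∈ lattice k T ∧ dist T f α ≤ ρ}

/-- All sub-simplices (of dimensions `0, …, n`) of the simplex with vertex set `T`,
including `T` itself. -/
def subsimplices {V : Type*} (T : Finset V) : Set (Finset V) := {f | f.Nonempty ∧ f ⊆ T}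

/-- Dimension of the simplex with vertex set `f`. -/
def dim {V : Type*} (f : Finset V) : ℕ := f.card - 1

/-- The lattice piece `S_ℓ(f)`, `ℓ = dim f`, of the lattice on `T`: the tube `D(f, r_ℓ)` without the
tubes `D(e, r_i)` of all sub-simplices `e` of `f` of dimension `i < ℓ`.
For a vertex nothing is removed; for `f = T` the tube `D(T, r_n)` is the whole lattice. -/
def piece {V : Type*} (k : ℕ) (r : ℕ → ℕ) (T f : Finset V) : Set (V →₀ ℕ) :=
  tube k T f (r (dim f)) \ ⋃ e ∈ {e | e ∈ subsimplices f ∧ dim e < dim f}, tube k T e (r (dim e))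

/-- `T` is the vertex set of a nondegenerate `n`-simplex in `ℝⁿ`. -/
def IsSimplex {n : ℕ} (T : Finset (EuclideanSpace ℝ (Fin n))) : Prop :=
  AffineIndependent ℝ ((↑) : T → EuclideanSpace ℝ (Fin n)) ∧ T.card = n + 1

/-- The vertices of an `n`-simplex as an affine basis of `ℝⁿ`. -/
noncomputable def IsSimplex.basis {n : ℕ} {T : Finset (EuclideanSpace ℝ (Fin n))}
    (hT : IsSimplex T) : AffineBasis T ℝ (EuclideanSpace ℝ (Fin n)) where
  toFun := (↑)
  ind' := hT.1
  tot' := by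
    rw [hT.1.affineSpan_eq_top_iff_card_eq_finrank_add_one]
    simp [hT.2]

open scoped Classical in
/-- The barycentric coordinate `λ_v` of the `n`-simplex `T` at its vertex `v`
(an affine function on all of `ℝⁿ`). -/
noncomputable def bary {n : ℕ} (T : Finset (EuclideanSpace ℝ (Fin n)))
    (v x : EuclideanSpace ℝ (Fin n)) : ℝ :=
  if h : IsSimplex T ∧ v ∈ T then h.1.basis.coord ⟨v, h.2⟩ x else 0

/-- The Bernstein polynomial `λ^α` of the `n`-simplex `T`. -/
noncomputable def bernstein {n : ℕ} (T : Finset (EuclideanSpace ℝ (Fin n)))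
    (α : EuclideanSpace ℝ (Fin n) →₀ ℕ) (x : EuclideanSpace ℝ (Fin n)) : ℝ :=
  ∏ v ∈ T, bary T v x ^ α v

/-- Real polynomial functions on `ℝⁿ` of total degree at most `k`. -/
noncomputable def poly (n k : ℕ) : Submodule ℝ (EuclideanSpace ℝ (Fin n) → ℝ) :=
  (MvPolynomial.restrictTotalDegree (Fin n) ℝ k).map
    (LinearMap.pi fun x : EuclideanSpace ℝ (Fin n) =>
      (MvPolynomial.aeval (R := ℝ) (fun i => x i)).toLinearMap)

/-- The span of the Bernstein polynomials of `T` with exponents in `S`. -/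
noncomputable def polySpan {n : ℕ} (T : Finset (EuclideanSpace ℝ (Fin n)))
    (S : Set (EuclideanSpace ℝ (Fin n) →₀ ℕ)) : Submodule ℝ (EuclideanSpace ℝ (Fin n) → ℝ) :=
  Submodule.span ℝ (bernstein T '' S)

/-- The closed geometric simplex with vertex set `f`. -/
def hull {n : ℕ} (f : Finset (EuclideanSpace ℝ (Fin n))) : Set (EuclideanSpace ℝ (Fin n)) :=
  convexHull ℝ (f : Set (EuclideanSpace ℝ (Fin n)))

/-- The iterated directional derivative `∂^β u = ∂_{w_0}^{β_0} ∂_{w_1}^{β_1} ⋯ u`, where all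
derivatives are taken from within the set `A` (so only `u` on `A` matters). -/
noncomputable def multiDeriv {n d : ℕ} (A : Set (EuclideanSpace ℝ (Fin n)))
    (w : Fin d → EuclideanSpace ℝ (Fin n)) (β : Fin d → ℕ)
    (u : EuclideanSpace ℝ (Fin n) → ℝ) : EuclideanSpace ℝ (Fin n) → ℝ :=
  (List.finRange d).foldr
    (fun i g => (fun (g' : EuclideanSpace ℝ (Fin n) → ℝ) x => fderivWithin ℝ g' A x (w i))^[β i] g)
    u

/-- Labels of the degrees of freedom: derivatives `D^α` at vertices, normal derivative moments on
sub-simplices (tested against `λ_f^a`), and interior moments. -/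
inductive DoF (n : ℕ) : Type
  | vertex (v : EuclideanSpace ℝ (Fin n)) (α : Fin n → ℕ) : DoF n
  | face (f : Finset (EuclideanSpace ℝ (Fin n))) (a : EuclideanSpace ℝ (Fin n) →₀ ℕ)
      (β : Fin (n + 1 - f.card) → ℕ) : DoF n
  | cell (T : Finset (EuclideanSpace ℝ (Fin n))) (α : EuclideanSpace ℝ (Fin n) →₀ ℕ) : DoF n

open scoped Classical in
/-- The degrees of freedom of the `n`-simplex `T`. In the middle case `a = α_f` for some
`α ∈ S_ℓ(f)`, `s = |β|`, `|α_f| = k - s` and `1 ≤ ℓ = dim f ≤ n - 1`. -/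
def localDoFs {n : ℕ} (k : ℕ) (r : ℕ → ℕ) (T : Finset (EuclideanSpace ℝ (Fin n))) : Set (DoF n)
  | .vertex v α => v ∈ T ∧ ∑ i, α i ≤ r 0
  | .face f a β => f ∈ subsimplices T ∧ 1 ≤ dim f ∧ dim f < n ∧ ∑ i, β i ≤ r (dim f) ∧
      ∃ α ∈ piece k r T f, a = α.filter (· ∈ f) ∧ ∑ v ∈ f, α v + ∑ i, β i = k
  | .cell T' α => T' = T ∧ α ∈ piece k r T T

/-- The value of a degree of freedom on `u|_T`; `ν f` is the chosen frame `n_f` of the normal plane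
of `f`. Integrals over `f` are with respect to the `dim f`-dimensional surface measure. -/
noncomputable def dofValue {n : ℕ}
    (ν : (f : Finset (EuclideanSpace ℝ (Fin n))) →
      Fin (n + 1 - f.card) → EuclideanSpace ℝ (Fin n))
    (T : Finset (EuclideanSpace ℝ (Fin n))) (u : EuclideanSpace ℝ (Fin n) → ℝ) : DoF n → ℝ
  | .vertex v α => multiDeriv (hull T) (fun i => EuclideanSpace.single i (1 : ℝ)) α u v
  | .face f a β => ∫ x in hull f, multiDeriv (hull T) (ν f) β u x * bernstein T a x
      ∂(MeasureTheory.Measure.euclideanHausdorffMeasure (dim f))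
  | .cell _ α => ∫ x in hull T, u x * bernstein T α x

/-- `w` is a basis of the normal plane of the simplex `f`; that plane has dimension
`n - dim f = n + 1 - f.card`. -/
def IsNormalFrame {n : ℕ} (f : Finset (EuclideanSpace ℝ (Fin n)))
    (w : Fin (n + 1 - f.card) → EuclideanSpace ℝ (Fin n)) : Prop :=
  LinearIndependent ℝ w ∧
    Submodule.span ℝ (Set.range w) =
      (vectorSpan ℝ (f : Set (EuclideanSpace ℝ (Fin n))))ᗮ

/-- `Th` is the set of cells of a conforming simplicial mesh with `closure Ω = ⋃ T`: cells are
nondegenerate `n`-simplices and two cells meet in the simplex spanned by their common vertices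
(which is empty if there are none). -/
structure IsMesh {n : ℕ} (Th : Finset (Finset (EuclideanSpace ℝ (Fin n))))
    (Ω : Set (EuclideanSpace ℝ (Fin n))) : Prop where
  simplex : ∀ T ∈ Th, IsSimplex T
  conforming : ∀ T ∈ Th, ∀ T' ∈ Th, hull T ∩ hull T' =
    convexHull ℝ ((T : Set (EuclideanSpace ℝ (Fin n))) ∩ (T' : Set (EuclideanSpace ℝ (Fin n))))
  isOpen : IsOpen Ω
  closure_eq : closure Ω = ⋃ T ∈ Th, hull T

/-- The degrees of freedom of the mesh; those of a vertex or sub-simplex shared by several cells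
are counted once. -/
def globalDoFs {n : ℕ} (k : ℕ) (r : ℕ → ℕ) (Th : Finset (Finset (EuclideanSpace ℝ (Fin n)))) :
    Set (DoF n) := {d | ∃ T ∈ Th, d ∈ localDoFs k r T}

/-- The finite element space `V_h`. Functions on `closure Ω` are represented by their extension by
zero. Single-valuedness only restricts vertex and sub-simplex degrees of freedom, since an interior
one belongs to one cell only. -/
def feSpace {n : ℕ} (m k : ℕ) (r : ℕ → ℕ)
    (ν : (f : Finset (EuclideanSpace ℝ (Fin n))) →
      Fin (n + 1 - f.card) → EuclideanSpace ℝ (Fin n))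
    (Th : Finset (Finset (EuclideanSpace ℝ (Fin n)))) (Ω : Set (EuclideanSpace ℝ (Fin n))) :
    Set (EuclideanSpace ℝ (Fin n) → ℝ) :=
  {u | (∀ x, x ∉ closure Ω → u x = 0) ∧
    ContDiffOn ℝ m u Ω ∧
    (∀ T ∈ Th, ∃ p ∈ poly n k, Set.EqOn u p (hull T)) ∧
    ∀ T ∈ Th, ∀ T' ∈ Th, ∀ d ∈ localDoFs k r T ∩ localDoFs k r T',
      dofValue ν T u d = dofValue ν T' u d}

end SmoothFE

open MeasureTheory

namespace SmoothFE

section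

/-! Everything is read off from the Bernstein form u = ∑ c_α λ^α with |α| = k, the nodes being
sorted by their distance to sub-simplices.

Decomposition. Suppose a node lies in the tubes of f and g, with dim f ≤ dim g and f not contained
in g. Its distance to f ∩ g is at most the sum of its distances to f and g, hence at most 2 r_{dim
f}. The halving condition then puts it in a tube already removed from the piece of f, and k > 2 r_0
excludes f ∩ g = ∅ (`pairwiseDisjoint_piece`). Linear independence of the Bernstein polynomials
carries the partition over to their spans.

Unisolvence. Let x ∈ f and suppose that the coefficients at distance less than s from f vanish.
Along x + t w the polynomial λ^α starts with the power t^{dist(α, f)}, so the s-th derivative of u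
in the direction w is s! times the sum, over the nodes at distance s, of c_α λ_f^{α_f} ∏_{v ∉ f}
(∂_w λ_v)^{α_v}. Nodes in tubes of smaller sub-simplices have c_α = 0 by induction, so every
λ_f^{α_f} that survives is a test function of some DoF. Hence this polynomial is L²(f)-orthogonal to
itself and vanishes. Independence of the λ_f^a on f, and the freedom to prescribe the ∂_w λ_v, then
give c_α = 0 (`coeff_eq_zero_of_moments`, `coeff_eq_zero_of_dofs`). The DoFs inject into the nodes
(`exists_injective_localDoFs`), so an injective DoF map is bijective.

Conformity. The argument on f uses only DoFs carried by sub-simplices of f. With f = T ∩ T' and the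
difference of two cell polynomials, it leaves only coefficients at distance greater than r_{dim f} ≥
r_{n-1} = m. The difference therefore lies in the power m + 1 of the ideal generated by the λ_v, v ∉
f, and all its derivatives up to order m vanish on f (`vanishesTo_sub`). Gluing the cells gives a
C^m function, and global unisolvence is local unisolvence followed by gluing. -/

/-- The Euclidean space `ℝⁿ`. -/
abbrev E (n : ℕ) := EuclideanSpace ℝ (Fin n)

variable {n : ℕ} {T T' f : Finset (E n)}

/-! ### Barycentric coordinates -/

theorem bary_eq_coord (hT : IsSimplex T) (v : T) (x : E n) :
    bary T v x = hT.basis.coord v x := by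
  rw [bary, dif_pos ⟨hT, v.2⟩]

theorem sum_bary (hT : IsSimplex T) (x : E n) : ∑ v ∈ T, bary T v x = 1 := by
  rw [← Finset.sum_coe_sort]
  simp_rw [bary_eq_coord hT]
  exact hT.basis.sum_coord_apply_eq_one x

theorem sum_bary_smul (hT : IsSimplex T) (x : E n) : ∑ v ∈ T, bary T v x • v = x := by
  rw [← Finset.sum_coe_sort T (fun v => bary T v x • v)]
  simp_rw [bary_eq_coord hT]
  exact hT.basis.linear_combination_coord_eq_self x

theorem bary_sum_smul (hT : IsSimplex T) {y : E n → ℝ} (hy : ∑ v ∈ T, y v = 1) {v : E n}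
    (hv : v ∈ T) : bary T v (∑ u ∈ T, y u • u) = y v := by
  have h1 : ∑ u : T, y u = 1 := by rw [← hy, ← Finset.sum_coe_sort T y]
  rw [show bary T v _ = _ from bary_eq_coord hT ⟨v, hv⟩ _, ← Finset.sum_coe_sort T (fun u => y u • u)]
  have := hT.basis.coord_apply_combination_of_mem (s := Finset.univ) (Finset.mem_univ ⟨v, hv⟩)
    (w := fun u : T => y u) h1
  rwa [Finset.affineCombination_eq_linear_combination _ _ _ h1] at this

/-- The barycentric coordinate as an affine map. -/
theorem exists_affineMap_bary (T : Finset (E n)) (v : E n) :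
    ∃ g : E n →ᵃ[ℝ] ℝ, ⇑g = bary T v := by
  by_cases h : IsSimplex T ∧ v ∈ T
  · refine ⟨h.1.basis.coord ⟨v, h.2⟩, ?_⟩
    ext x
    rw [bary, dif_pos h]
  · refine ⟨0, ?_⟩
    ext x
    rw [bary, dif_neg h]
    rfl

/-- The directional derivative of the barycentric coordinate of `v` in the direction `w`. -/
noncomputable def baryDir (T : Finset (E n)) (v w : E n) : ℝ := bary T v w - bary T v 0

theorem exists_linearMap_baryDir (T : Finset (E n)) (v : E n) :
    ∃ g : E n →ₗ[ℝ] ℝ, (∀ w, g w = baryDir T v w) ∧ ∀ x w, bary T v (x + w) = bary T v x + g w := by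
  obtain ⟨g, hg⟩ := exists_affineMap_bary T v
  have key : ∀ x w, g (x + w) = g x + g.linear w := fun x w => by
    have := g.map_vadd x w
    simp only [vadd_eq_add] at this
    rw [add_comm x, this, add_comm]
  refine ⟨g.linear, fun w => ?_, fun x w => ?_⟩
  · rw [baryDir, ← hg, ← zero_add w, key]
    simp
  · rw [← hg, key]

theorem bary_add (T : Finset (E n)) (v x w : E n) :
    bary T v (x + w) = bary T v x + baryDir T v w := by
  obtain ⟨g, h1, h2⟩ := exists_linearMap_baryDir T v
  rw [h2, h1]

theorem baryDir_add (T : Finset (E n)) (v x w : E n) :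
    baryDir T v (x + w) = baryDir T v x + baryDir T v w := by
  obtain ⟨g, h1, -⟩ := exists_linearMap_baryDir T v
  simp [← h1]

theorem baryDir_smul (T : Finset (E n)) (v w : E n) (t : ℝ) :
    baryDir T v (t • w) = t * baryDir T v w := by
  obtain ⟨g, h1, -⟩ := exists_linearMap_baryDir T v
  simp [← h1]

theorem baryDir_sum {ι : Type*} (T : Finset (E n)) (v : E n) (s : Finset ι) (w : ι → E n) :
    baryDir T v (∑ i ∈ s, w i) = ∑ i ∈ s, baryDir T v (w i) := by
  obtain ⟨g, h1, -⟩ := exists_linearMap_baryDir T v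
  simp [← h1]

theorem baryDir_sub (T : Finset (E n)) (v x y : E n) :
    baryDir T v (x - y) = bary T v x - bary T v y := by
  have := bary_add T v y (x - y)
  rw [add_sub_cancel] at this
  linarith

theorem continuous_bary (T : Finset (E n)) (v : E n) : Continuous (bary T v) := by
  obtain ⟨g, hg⟩ := exists_affineMap_bary T v
  rw [← hg]
  exact g.continuous_of_finiteDimensional

theorem bary_of_mem_hull (hT : IsSimplex T) (hf : f ⊆ T) {y : E n → ℝ} (hy : ∑ v ∈ f, y v = 1)
    {v : E n} (hv : v ∈ T) [Decidable (v ∈ f)] :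
    bary T v (∑ u ∈ f, y u • u) = if v ∈ f then y v else 0 := by
  classical
  have h1 : ∑ u ∈ f, y u • u = ∑ u ∈ T, (if u ∈ f then y u else 0) • u := by
    simp_rw [ite_smul, zero_smul, ← Finset.sum_filter, Finset.filter_mem_eq_inter,
      Finset.inter_eq_right.2 hf]
  have h2 : ∑ u ∈ T, (if u ∈ f then y u else 0) = 1 := by
    simp_rw [← Finset.sum_filter, Finset.filter_mem_eq_inter, Finset.inter_eq_right.2 hf, hy]
  rw [h1, bary_sum_smul hT h2 hv]
  congr

theorem bary_apply (hT : IsSimplex T) {u v : E n} (hu : u ∈ T) (hv : v ∈ T) [Decidable (v = u)] :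
    bary T v u = if v = u then 1 else 0 := by
  classical
  have := bary_of_mem_hull hT (f := {u}) (y := fun _ => 1) (by simpa using hu) (by simp) hv
  simpa using this

theorem mem_hull_iff (hT : IsSimplex T) (hf : f ⊆ T) {x : E n} :
    x ∈ hull f ↔ (∀ v ∈ f, 0 ≤ bary T v x) ∧ ∀ v ∈ T, v ∉ f → bary T v x = 0 := by
  classical
  constructor
  · intro hx
    obtain ⟨y, h0, h1, rfl⟩ := Finset.mem_convexHull'.1 hx
    refine ⟨fun v hv => ?_, fun v hv hvf => ?_⟩
    · rw [bary_of_mem_hull hT hf h1 (hf hv), if_pos hv]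
      exact h0 v hv
    · rw [bary_of_mem_hull hT hf h1 hv, if_neg hvf]
  · rintro ⟨h0, h1⟩
    refine Finset.mem_convexHull'.2 ⟨fun v => bary T v x, h0, ?_, ?_⟩
    · rw [← sum_bary hT x]
      exact Finset.sum_subset hf h1
    · conv_rhs => rw [← sum_bary_smul hT x]
      exact Finset.sum_subset hf fun v hv hvf => by simp only [h1 v hv hvf, zero_smul]

/-- On f both coordinates are the weight of v in the convex combination of the vertices of f. This
makes the test functions on a shared sub-simplex independent of the cell. -/
theorem bary_congr (hT : IsSimplex T) (hT' : IsSimplex T') (hf : f ⊆ T) (hf' : f ⊆ T')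
    {x : E n} (hx : x ∈ hull f) {v : E n} (hv : v ∈ f) : bary T v x = bary T' v x := by
  classical
  obtain ⟨y, h0, h1, rfl⟩ := Finset.mem_convexHull'.1 hx
  rw [bary_of_mem_hull hT hf h1 (hf hv), bary_of_mem_hull hT' hf' h1 (hf' hv)]

theorem bernstein_eq_prod (hf : f ⊆ T) {a : E n →₀ ℕ} (ha : a.support ⊆ f) (x : E n) :
    bernstein T a x = ∏ v ∈ f, bary T v x ^ a v := by
  refine (Finset.prod_subset hf fun v _ hv => ?_).symm
  rw [Finsupp.notMem_support_iff.1 fun h => hv (ha h), pow_zero]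

theorem bernstein_congr (hT : IsSimplex T) (hT' : IsSimplex T') (hf : f ⊆ T) (hf' : f ⊆ T')
    {a : E n →₀ ℕ} (ha : a.support ⊆ f) {x : E n} (hx : x ∈ hull f) :
    bernstein T a x = bernstein T' a x := by
  rw [bernstein_eq_prod hf ha, bernstein_eq_prod hf' ha]
  exact Finset.prod_congr rfl fun v hv => by rw [bary_congr hT hT' hf hf' hx hv]

/-! ### Polynomial functions and their derivatives -/

/-- The function on `ℝⁿ` given by a polynomial. -/
noncomputable def polyFun (Q : MvPolynomial (Fin n) ℝ) (x : E n) : ℝ :=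
  MvPolynomial.aeval (R := ℝ) (fun i => x i) Q

theorem polyFun_eq_eval (Q : MvPolynomial (Fin n) ℝ) (x : E n) :
    polyFun Q x = MvPolynomial.eval (fun i => x i) Q := rfl

theorem mem_poly {k : ℕ} {u : E n → ℝ} :
    u ∈ poly n k ↔ ∃ Q : MvPolynomial (Fin n) ℝ, Q.totalDegree ≤ k ∧ polyFun Q = u := by
  simp only [poly, Submodule.mem_map, MvPolynomial.mem_restrictTotalDegree]
  rfl

@[simp] theorem polyFun_add (P Q : MvPolynomial (Fin n) ℝ) (x : E n) :
    polyFun (P + Q) x = polyFun P x + polyFun Q x := by simp [polyFun]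

@[simp] theorem polyFun_sub (P Q : MvPolynomial (Fin n) ℝ) (x : E n) :
    polyFun (P - Q) x = polyFun P x - polyFun Q x := by simp [polyFun]

@[simp] theorem polyFun_mul (P Q : MvPolynomial (Fin n) ℝ) (x : E n) :
    polyFun (P * Q) x = polyFun P x * polyFun Q x := by simp [polyFun]

@[simp] theorem polyFun_pow (P : MvPolynomial (Fin n) ℝ) (j : ℕ) (x : E n) :
    polyFun (P ^ j) x = polyFun P x ^ j := by simp [polyFun]

@[simp] theorem polyFun_smul (c : ℝ) (Q : MvPolynomial (Fin n) ℝ) (x : E n) :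
    polyFun (c • Q) x = c * polyFun Q x := by simp [polyFun]

@[simp] theorem polyFun_zero (x : E n) : polyFun 0 x = 0 := by simp [polyFun]

@[simp] theorem polyFun_sum {ι : Type*} (s : Finset ι) (P : ι → MvPolynomial (Fin n) ℝ) (x : E n) :
    polyFun (∑ i ∈ s, P i) x = ∑ i ∈ s, polyFun (P i) x := by simp [polyFun]

@[simp] theorem polyFun_prod {ι : Type*} (s : Finset ι) (P : ι → MvPolynomial (Fin n) ℝ)
    (x : E n) : polyFun (∏ i ∈ s, P i) x = ∏ i ∈ s, polyFun (P i) x := by simp [polyFun]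

@[simp] theorem polyFun_C (c : ℝ) (x : E n) : polyFun (MvPolynomial.C c) x = c := by
  simp [polyFun]

@[simp] theorem polyFun_X (i : Fin n) (x : E n) : polyFun (MvPolynomial.X i) x = x i := by
  simp [polyFun]

theorem polyFun_injective : Function.Injective (polyFun (n := n)) := by
  intro P Q h
  refine MvPolynomial.funext fun x => ?_
  have := congrFun h (WithLp.toLp 2 x)
  simpa [polyFun_eq_eval] using this

/-- Differentiation of polynomials in the direction `w`. -/
noncomputable def dirDeriv (w : E n) :
    Derivation ℝ (MvPolynomial (Fin n) ℝ) (MvPolynomial (Fin n) ℝ) :=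
  MvPolynomial.mkDerivation ℝ fun i => MvPolynomial.C (w i)

@[simp] theorem dirDeriv_X (w : E n) (i : Fin n) :
    dirDeriv w (MvPolynomial.X i) = MvPolynomial.C (w i) := MvPolynomial.mkDerivation_X ..

@[simp] theorem dirDeriv_C (w : E n) (c : ℝ) : dirDeriv w (MvPolynomial.C c) = 0 :=
  MvPolynomial.derivation_C ..

theorem hasFDerivAt_polyFun (Q : MvPolynomial (Fin n) ℝ) (x : E n) :
    ∃ L : E n →L[ℝ] ℝ, HasFDerivAt (polyFun Q) L x ∧ ∀ w, L w = polyFun (dirDeriv w Q) x := by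
  induction Q using MvPolynomial.induction_on with
  | C c =>
    refine ⟨0, ?_, by simp⟩
    rw [show polyFun (MvPolynomial.C c) = fun _ : E n => c from funext (by simp)]
    exact hasFDerivAt_const c x
  | add P Q hP hQ =>
    obtain ⟨L, hL, hL'⟩ := hP
    obtain ⟨M, hM, hM'⟩ := hQ
    refine ⟨L + M, ?_, fun w => by simp [hL', hM']⟩
    rw [show polyFun (P + Q) = polyFun P + polyFun Q from funext (by simp)]
    exact hL.add hM
  | mul_X P i hP =>
    obtain ⟨L, hL, hL'⟩ := hP
    refine ⟨polyFun P x • EuclideanSpace.proj i + x i • L, ?_, fun w => ?_⟩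
    · rw [show polyFun (P * MvPolynomial.X i) = polyFun P * fun y : E n => y i from
        funext (by simp)]
      exact hL.mul (EuclideanSpace.proj (𝕜 := ℝ) i).hasFDerivAt
    · simp [hL', Derivation.leibniz]

theorem continuous_polyFun (Q : MvPolynomial (Fin n) ℝ) : Continuous (polyFun Q) :=
  continuous_iff_continuousAt.2 fun x =>
    (hasFDerivAt_polyFun Q x).choose_spec.1.continuousAt

/-- The iterated directional derivative of polynomials, cf. `multiDeriv`. -/
noncomputable def polyMultiDeriv {d : ℕ} (w : Fin d → E n) (β : Fin d → ℕ)
    (Q : MvPolynomial (Fin n) ℝ) : MvPolynomial (Fin n) ℝ :=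
  (List.finRange d).foldr (fun i g => (dirDeriv (w i))^[β i] g) Q

theorem eqOn_fderivWithin {A : Set (E n)} (hA : UniqueDiffOn ℝ A) {u : E n → ℝ}
    {Q : MvPolynomial (Fin n) ℝ} (h : Set.EqOn u (polyFun Q) A) (w : E n) :
    Set.EqOn (fun x => fderivWithin ℝ u A x w) (polyFun (dirDeriv w Q)) A := by
  intro x hx
  obtain ⟨L, hL, hL'⟩ := hasFDerivAt_polyFun Q x
  have : HasFDerivWithinAt u L A x := hL.hasFDerivWithinAt.congr h (h hx)
  simp only [this.fderivWithin (hA x hx), hL']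

/-- Derivatives within a set of unique differentiability are determined by the values on it, so the
analytic derivatives in the DoFs may be replaced by algebraic ones. -/
theorem eqOn_multiDeriv {A : Set (E n)} (hA : UniqueDiffOn ℝ A) {u : E n → ℝ}
    {Q : MvPolynomial (Fin n) ℝ} (h : Set.EqOn u (polyFun Q) A) {d : ℕ} (w : Fin d → E n)
    (β : Fin d → ℕ) : Set.EqOn (multiDeriv A w β u) (polyFun (polyMultiDeriv w β Q)) A := by
  rw [multiDeriv, polyMultiDeriv]
  induction List.finRange d with
  | nil => exact h
  | cons i l ih =>
    simp only [List.foldr_cons]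
    induction β i with
    | zero => exact ih
    | succ j ihj =>
      rw [Function.iterate_succ_apply', Function.iterate_succ_apply']
      exact eqOn_fderivWithin hA ihj (w i)

theorem uniqueDiffOn_hull (hT : IsSimplex T) : UniqueDiffOn ℝ (hull T) := by
  refine uniqueDiffOn_convex (convex_convexHull ℝ _) ?_
  rw [hull, interior_convexHull_nonempty_iff_affineSpan_eq_top]
  have := hT.basis.tot
  rwa [show ⇑hT.basis = ((↑) : T → E n) from rfl, Subtype.range_coe] at this

/-- A degree of freedom of a piecewise polynomial function. -/
theorem dofValue_congr {ν : (f : Finset (E n)) → Fin (n + 1 - f.card) → E n} (hT : IsSimplex T)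
    {u : E n → ℝ} {Q : MvPolynomial (Fin n) ℝ} (h : Set.EqOn u (polyFun Q) (hull T)) {k : ℕ}
    {r : ℕ → ℕ} {d : DoF n} (hd : d ∈ localDoFs k r T) :
    dofValue ν T u d = match d with
      | .vertex v α => polyFun (polyMultiDeriv (fun i => EuclideanSpace.single i (1 : ℝ)) α Q) v
      | .face f a β => ∫ x in hull f, polyFun (polyMultiDeriv (ν f) β Q) x * bernstein T a x
          ∂(Measure.euclideanHausdorffMeasure (dim f))
      | .cell _ α => ∫ x in hull T, polyFun Q x * bernstein T α x := by
  have hm : ∀ f : Finset (E n), MeasurableSet (hull f) := fun f =>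
    (f.finite_toSet.isCompact_convexHull (𝕜 := ℝ)).measurableSet
  cases d with
  | vertex v α =>
    exact eqOn_multiDeriv (uniqueDiffOn_hull hT) h _ _ (subset_convexHull ℝ _ hd.1)
  | face f a β =>
    refine setIntegral_congr_fun (hm f) fun x hx => ?_
    simp only [eqOn_multiDeriv (uniqueDiffOn_hull hT) h (ν f) β (convexHull_mono hd.1.2 hx)]
  | cell T' α =>
    refine setIntegral_congr_fun (hm T) fun x hx => ?_
    simp only [h hx]

/-! ### Bernstein polynomials as elements of the polynomial ring -/

/-- The barycentric coordinate as a polynomial. -/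
noncomputable def baryPoly (T : Finset (E n)) (v : E n) : MvPolynomial (Fin n) ℝ :=
  MvPolynomial.C (bary T v 0) +
    ∑ i, baryDir T v (EuclideanSpace.single i (1 : ℝ)) • MvPolynomial.X i

theorem sum_smul_single (x : E n) : ∑ i, x i • EuclideanSpace.single i (1 : ℝ) = x := by
  ext j
  simp [Finset.sum_apply, Pi.single_apply]

@[simp] theorem polyFun_baryPoly (T : Finset (E n)) (v x : E n) :
    polyFun (baryPoly T v) x = bary T v x := by
  have := bary_add T v 0 x
  rw [zero_add] at this
  rw [this]
  conv_rhs => rw [← sum_smul_single x, baryDir_sum]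
  simp [baryPoly, baryDir_smul, mul_comm]

theorem totalDegree_baryPoly_le (T : Finset (E n)) (v : E n) : (baryPoly T v).totalDegree ≤ 1 := by
  refine (MvPolynomial.totalDegree_add _ _).trans (max_le (by simp) ?_)
  refine MvPolynomial.totalDegree_finsetSum_le fun i _ => ?_
  exact (MvPolynomial.totalDegree_smul_le _ _).trans (by simp)

/-- The Bernstein polynomial as an element of the polynomial ring. -/
noncomputable def bernPoly (T : Finset (E n)) (α : E n →₀ ℕ) : MvPolynomial (Fin n) ℝ :=
  ∏ v ∈ T, baryPoly T v ^ α v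

@[simp] theorem polyFun_bernPoly (T : Finset (E n)) (α : E n →₀ ℕ) (x : E n) :
    polyFun (bernPoly T α) x = bernstein T α x := by
  simp [bernPoly, bernstein]

theorem totalDegree_bernPoly_le (T : Finset (E n)) (α : E n →₀ ℕ) :
    (bernPoly T α).totalDegree ≤ ∑ v ∈ T, α v := by
  refine (MvPolynomial.totalDegree_finsetProd _ _).trans (Finset.sum_le_sum fun v _ => ?_)
  refine (MvPolynomial.totalDegree_pow _ _).trans ?_
  simpa using Nat.mul_le_mul_left (α v) (totalDegree_baryPoly_le T v)

/-! ### Restriction of polynomials to lines -/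

/-- Restriction of a polynomial to the line `t ↦ x + t w`. -/
noncomputable def lineHom (x w : E n) : MvPolynomial (Fin n) ℝ →ₐ[ℝ] Polynomial ℝ :=
  MvPolynomial.aeval fun i => Polynomial.C (x i) + Polynomial.X * Polynomial.C (w i)

theorem lineHom_X (x w : E n) (i : Fin n) : lineHom x w (MvPolynomial.X i) =
    Polynomial.C (x i) + Polynomial.X * Polynomial.C (w i) := MvPolynomial.aeval_X ..

theorem eval_lineHom (x w : E n) (Q : MvPolynomial (Fin n) ℝ) (t : ℝ) :
    (lineHom x w Q).eval t = polyFun Q (x + t • w) := by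
  induction Q using MvPolynomial.induction_on with
  | C c => simp [lineHom]
  | add P Q hP hQ => simp [hP, hQ]
  | mul_X P i hP =>
    rw [map_mul, Polynomial.eval_mul, hP, lineHom_X, polyFun_mul]
    rw [Polynomial.eval_add, Polynomial.eval_C, Polynomial.eval_mul, Polynomial.eval_X,
      Polynomial.eval_C, polyFun_X, PiLp.add_apply, PiLp.smul_apply, smul_eq_mul]

theorem lineHom_baryPoly (T : Finset (E n)) (v x w : E n) :
    lineHom x w (baryPoly T v) =
      Polynomial.C (bary T v x) + Polynomial.X * Polynomial.C (baryDir T v w) := by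
  refine Polynomial.funext fun t => ?_
  simp [eval_lineHom, bary_add, baryDir_smul]
  ring

theorem lineHom_dirDeriv (x w : E n) (Q : MvPolynomial (Fin n) ℝ) :
    lineHom x w (dirDeriv w Q) = Polynomial.derivative (lineHom x w Q) := by
  induction Q using MvPolynomial.induction_on with
  | C c => simp [lineHom]
  | add P Q hP hQ => simp [hP, hQ]
  | mul_X P i hP =>
    simp only [Derivation.leibniz, map_add, smul_eq_mul, map_mul, hP, dirDeriv_X,
      Polynomial.derivative_mul]
    simp [lineHom]
    ring

/-- Taylor's formula along a line: differentiating in the direction w is differentiating in t after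
restriction, and the value at t = 0 is a coefficient. -/
theorem polyFun_iterate_dirDeriv (x w : E n) (s : ℕ) (Q : MvPolynomial (Fin n) ℝ) :
    polyFun ((dirDeriv w)^[s] Q) x = s.factorial * (lineHom x w Q).coeff s := by
  have h1 : lineHom x w ((dirDeriv w)^[s] Q) = Polynomial.derivative^[s] (lineHom x w Q) := by
    induction s with
    | zero => rfl
    | succ s ih => rw [Function.iterate_succ_apply', Function.iterate_succ_apply',
        lineHom_dirDeriv, ih]
  have h2 := eval_lineHom x w ((dirDeriv w)^[s] Q) 0
  rw [zero_smul, add_zero, h1, ← Polynomial.coeff_zero_eq_eval_zero,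
    Polynomial.coeff_iterate_derivative] at h2
  rw [← h2]
  simp [Nat.descFactorial_self]

/-! ### Leading terms of Bernstein polynomials at a sub-simplex -/

open scoped Classical in
/-- The restriction of a multi-index to a sub-simplex. -/
noncomputable def restr {V : Type*} (f : Finset V) (α : V →₀ ℕ) : V →₀ ℕ := α.filter (· ∈ f)

theorem restr_apply_of_mem {V : Type*} {f : Finset V} {v : V} (hv : v ∈ f) (α : V →₀ ℕ) :
    restr f α v = α v := by
  classical
  exact Finsupp.filter_apply_pos (· ∈ f) α hv

theorem restr_apply_of_notMem {V : Type*} {f : Finset V} {v : V} (hv : v ∉ f) (α : V →₀ ℕ) :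
    restr f α v = 0 := by
  classical
  exact Finsupp.filter_apply_neg (· ∈ f) α hv

theorem support_restr_subset {V : Type*} (f : Finset V) (α : V →₀ ℕ) :
    (restr f α).support ⊆ f := fun v hv => by
  by_contra h
  exact Finsupp.mem_support_iff.1 hv (restr_apply_of_notMem h α)

open scoped Classical in
/-- The product of powers of the values `b v` at the vertices of `T` outside `f`. -/
noncomputable def normalCoeff {V : Type*} (T f : Finset V) (α : V →₀ ℕ) (b : V → ℝ) : ℝ :=
  ∏ v ∈ T \ f, b v ^ α v

open scoped Classical in
theorem prod_eq_prod_mul_prod_sdiff {V R : Type*} [CommMonoid R] {T f : Finset V} (hf : f ⊆ T)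
    {g h : V → R} (hgh : ∀ v ∈ T, v ∉ f → g v = h v) :
    ∏ v ∈ T, g v = (∏ v ∈ f, g v) * ∏ v ∈ T \ f, h v := by
  rw [← Finset.prod_sdiff hf, mul_comm]
  congr 1
  refine Finset.prod_congr rfl fun v hv => ?_
  obtain ⟨hv1, hv2⟩ := Finset.mem_sdiff.1 hv
  exact hgh v hv1 hv2

open scoped Classical in
/-- The leading coefficient of a Bernstein polynomial at a sub-simplex in the direction `w`. -/
theorem coeff_lineHom_bernPoly (hT : IsSimplex T) (hf : f ⊆ T) {x : E n} (hx : x ∈ hull f)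
    (w : E n) (α : E n →₀ ℕ) (s : ℕ) (hs : s ≤ dist T f α) :
    (lineHom x w (bernPoly T α)).coeff s =
      if dist T f α = s then bernstein T (restr f α) x * normalCoeff T f α (baryDir T · w) else 0 := by
  have h0 := ((mem_hull_iff hT hf).1 hx).2
  -- At a point of f the factors belonging to vertices outside f have no constant term, so together
  -- they contribute exactly the power `dist T f α` of the line parameter.
  have h1 : lineHom x w (bernPoly T α) =
      (∏ v ∈ f, (Polynomial.C (bary T v x) + Polynomial.X * Polynomial.C (baryDir T v w)) ^ α v)
        * Polynomial.C (normalCoeff T f α (baryDir T · w)) * Polynomial.X ^ dist T f α := by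
    rw [bernPoly, map_prod, prod_eq_prod_mul_prod_sdiff hf (h := fun v =>
      Polynomial.C (baryDir T v w ^ α v) * Polynomial.X ^ α v), Finset.prod_mul_distrib,
      Finset.prod_pow_eq_pow_sum, dist, normalCoeff, map_prod, mul_assoc]
    · simp_rw [map_pow, lineHom_baryPoly]
    · intro v hv1 hv2
      rw [map_pow, lineHom_baryPoly, h0 v hv1 hv2]
      simp only [map_zero, zero_add, mul_pow, map_pow, mul_comm]
  rw [h1, Polynomial.coeff_mul_X_pow']
  by_cases h : dist T f α = s
  · rw [if_pos h.le, if_pos h, h, Nat.sub_self, Polynomial.mul_coeff_zero, Polynomial.coeff_C_zero,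
      Polynomial.coeff_zero_eq_eval_zero, Polynomial.eval_prod]
    congr 1
    rw [bernstein_eq_prod hf (support_restr_subset f α)]
    refine Finset.prod_congr rfl fun v hv => ?_
    simp [restr_apply_of_mem hv]
  · rw [if_neg h, if_neg (by omega)]

/-! ### Polarization -/

theorem commute_dirDeriv (w w' : E n) :
    Commute (dirDeriv w : Module.End ℝ (MvPolynomial (Fin n) ℝ))
      (dirDeriv w' : Module.End ℝ (MvPolynomial (Fin n) ℝ)) := by
  have : ⁅dirDeriv w, dirDeriv w'⁆ = 0 := MvPolynomial.derivation_ext fun i => by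
    simp [Derivation.commutator_apply]
  refine LinearMap.ext fun Q => sub_eq_zero.1 ?_
  have h := congrArg (fun D : Derivation ℝ _ _ => D Q) this
  simpa [Derivation.commutator_apply] using h

theorem dirDeriv_sum_smul {d : ℕ} (w : Fin d → E n) (z : Fin d → ℝ) :
    (dirDeriv (∑ i, z i • w i) : Module.End ℝ (MvPolynomial (Fin n) ℝ)) =
      ∑ i, z i • (dirDeriv (w i) : Module.End ℝ (MvPolynomial (Fin n) ℝ)) := by
  have : dirDeriv (∑ i, z i • w i) = ∑ i, z i • dirDeriv (w i) :=
    MvPolynomial.derivation_ext fun j => by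
      rw [← Derivation.coeFnAddMonoidHom_apply (∑ i, z i • dirDeriv (w i)), map_sum,
        Finset.sum_apply]
      simp [MvPolynomial.smul_eq_C_mul]
  rw [this]
  refine LinearMap.ext fun Q => ?_
  rw [Derivation.coeFn_coe, ← Derivation.coeFnAddMonoidHom_apply, map_sum]
  simp

/-- If a functional vanishes on all mixed products of order `s` of commuting operators, it vanishes
on the `s`-th powers of their linear combinations. -/
theorem eq_zero_pow_sum_of_foldr {M : Type*} [AddCommGroup M] [Module ℝ M] {d : ℕ}
    (D : Fin d → Module.End ℝ M) (hD : ∀ i j, Commute (D i) (D j)) (z : Fin d → ℝ) (s : ℕ)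
    (φ : M →ₗ[ℝ] ℝ) (Q : M)
    (h : ∀ β : Fin d → ℕ, ∑ i, β i = s →
      φ ((List.finRange d).foldr (fun i g => (D i)^[β i] g) Q) = 0) :
    φ (((∑ i, z i • D i) ^ s) Q) = 0 := by
  induction d generalizing s φ with
  | zero =>
    cases s with
    | zero => simpa using h 0 (by simp)
    | succ s => simp
  | succ d ih =>
    -- Split off the operator `D 0` by the binomial theorem. Its power is absorbed into the
    -- functional, and the remaining operators fall under the induction hypothesis.
    rw [Fin.sum_univ_succ, Commute.add_pow]
    · rw [LinearMap.sum_apply, map_sum]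
      refine Finset.sum_eq_zero fun j hj => ?_
      have hj' : j ≤ s := by simpa [Nat.lt_succ_iff] using hj
      have := ih (fun i => D i.succ) (fun i j => hD _ _) (fun i => z i.succ) (s - j)
        (φ ∘ₗ (D 0 ^ j)) fun β hβ => by
          have := h (Fin.cons j β) (by simp [Fin.sum_univ_succ, hβ, hj'])
          simpa [List.finRange_succ, List.foldr_map, Module.End.pow_apply] using this
      rw [← nsmul_eq_mul', LinearMap.smul_apply, map_nsmul, smul_pow, Module.End.mul_apply,
        LinearMap.smul_apply, map_smul, show φ _ = 0 from this, smul_zero, smul_zero]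
    · refine Commute.smul_left (Commute.sum_right _ _ _ fun i _ => ?_) _
      exact (hD _ _).smul_right _

/-- Passes from the mixed derivatives in the DoFs to pure powers of one directional derivative, for
which the restriction to lines is available. -/
theorem eq_zero_iterate_dirDeriv_of_polyMultiDeriv {d : ℕ} (w : Fin d → E n) (z : Fin d → ℝ)
    (s : ℕ) (φ : MvPolynomial (Fin n) ℝ →ₗ[ℝ] ℝ) (Q : MvPolynomial (Fin n) ℝ)
    (h : ∀ β : Fin d → ℕ, ∑ i, β i = s → φ (polyMultiDeriv w β Q) = 0) :
    φ ((dirDeriv (∑ i, z i • w i))^[s] Q) = 0 := by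
  have := eq_zero_pow_sum_of_foldr (fun i => (dirDeriv (w i) : Module.End ℝ (MvPolynomial (Fin n) ℝ)))
    (fun i j => commute_dirDeriv _ _) z s φ Q h
  rwa [← dirDeriv_sum_smul, Module.End.pow_apply] at this

theorem polyMultiDeriv_linear {d : ℕ} (w : Fin d → E n) (β : Fin d → ℕ) :
    ∃ L : Module.End ℝ (MvPolynomial (Fin n) ℝ), ∀ Q, L Q = polyMultiDeriv w β Q := by
  simp only [polyMultiDeriv]
  induction List.finRange d with
  | nil => exact ⟨LinearMap.id, fun _ => rfl⟩
  | cons i l ih =>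
    obtain ⟨L, hL⟩ := ih
    refine ⟨((dirDeriv (w i) : Module.End ℝ _) ^ β i) ∘ₗ L, fun Q => ?_⟩
    simp only [List.foldr_cons, LinearMap.comp_apply, hL, Module.End.pow_apply]
    rfl

/-! ### Integration over sub-simplices -/

theorem baryDir_of_mem_vectorSpan (hT : IsSimplex T) (hf : f ⊆ T) {v : E n} (hv : v ∈ T)
    (hvf : v ∉ f) {w : E n} (hw : w ∈ vectorSpan ℝ (f : Set (E n))) : baryDir T v w = 0 := by
  classical
  obtain ⟨g, h1, -⟩ := exists_linearMap_baryDir T v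
  rw [← h1, ← LinearMap.mem_ker]
  refine (Submodule.span_le (p := LinearMap.ker g)).2 ?_ hw
  rintro _ ⟨x, hx, y, hy, rfl⟩
  change g (x - y) = 0
  rw [h1, baryDir_sub,
    bary_apply hT (hf hx) hv, bary_apply hT (hf hy) hv, if_neg, if_neg, sub_zero]
  · rintro rfl; exact hvf hy
  · rintro rfl; exact hvf hx

theorem finrank_vectorSpan (hT : IsSimplex T) (hf : f ⊆ T) (hne : f.Nonempty) :
    Module.finrank ℝ (vectorSpan ℝ (f : Set (E n))) = dim f := by
  have h : AffineIndependent ℝ ((↑) : f → E n) := hT.1.mono (s := (f : Set (E n))) hf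
  have hc : Fintype.card f = dim f + 1 := by
    rw [Fintype.card_coe, dim, Nat.sub_add_cancel hne.card_pos]
  have := h.finrank_vectorSpan hc
  have hs : Set.range ((↑) : f → E n) = f := Subtype.range_coe
  exact hs ▸ this

/-- The points of the simplex `f` with positive barycentric coordinates. -/
def relInt (T f : Finset (E n)) : Set (E n) :=
  {x | (∀ v ∈ f, 0 < bary T v x) ∧ ∀ v ∈ T, v ∉ f → bary T v x = 0}

theorem relInt_subset_hull (hT : IsSimplex T) (hf : f ⊆ T) : relInt T f ⊆ hull f := fun _ hx =>
  (mem_hull_iff hT hf).2 ⟨fun v hv => (hx.1 v hv).le, hx.2⟩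

theorem isCompact_hull (f : Finset (E n)) : IsCompact (hull f) :=
  f.finite_toSet.isCompact_convexHull (𝕜 := ℝ)

/-- A translation identifies the direction space of f isometrically with the affine hull of f, and
the surface measure is the image of the Hausdorff measure of that space. There it is finite on
compact sets and positive on nonempty open sets, which gives the two claims. -/
theorem integrableOn_hull_and_eq_zero (hT : IsSimplex T) (hf : f ⊆ T) (hne : f.Nonempty)
    {g : E n → ℝ} (hg : Continuous g) :
    IntegrableOn g (hull f) (Measure.euclideanHausdorffMeasure (dim f)) ∧
      ((∀ x, 0 ≤ g x) → ∫ x in hull f, g x ∂(Measure.euclideanHausdorffMeasure (dim f)) = 0 →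
        ∀ x ∈ relInt T f, g x = 0) := by
  obtain ⟨x₀, hx₀⟩ := hne
  rw [← finrank_vectorSpan hT hf ⟨x₀, hx₀⟩]
  set V := vectorSpan ℝ (f : Set (E n)) with hV
  let ι : V → E n := fun z => x₀ + z
  have hι : Isometry ι := (IsometryEquiv.addLeft x₀).isometry.comp isometry_subtype_coe
  have hιc : Topology.IsClosedEmbedding ι := hι.isClosedEmbedding
  have hr : hull f ⊆ Set.range ι := fun x hx => by
    have h1 := convexHull_subset_affineSpan _ hx
    have h2 := AffineSubspace.vsub_mem_direction h1 (subset_affineSpan ℝ _ hx₀)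
    rw [direction_affineSpan] at h2
    exact ⟨⟨x - x₀, h2⟩, by simp [ι]⟩
  have hK : IsCompact (ι ⁻¹' hull f) := hιc.isCompact_preimage (isCompact_hull f)
  have hμ : (Measure.euclideanHausdorffMeasure (Module.finrank ℝ V) : Measure (E n)).restrict
      (hull f) = ((Measure.euclideanHausdorffMeasure (Module.finrank ℝ V) :
        Measure V).map ι).restrict (hull f) := by
    rw [hι.map_euclideanHausdorffMeasure, Measure.restrict_restrict
      (isCompact_hull f).measurableSet, Set.inter_eq_left.2 hr]
  have hint : IntegrableOn (g ∘ ι) (ι ⁻¹' hull f)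
      (Measure.euclideanHausdorffMeasure (Module.finrank ℝ V)) :=
    (hg.comp hι.continuous).continuousOn.integrableOn_compact hK
  refine ⟨?_, fun h0 hz x hx => ?_⟩
  · rw [IntegrableOn, hμ]
    exact (hιc.measurableEmbedding.integrableOn_map_iff).2 hint
  · rw [hμ, hιc.measurableEmbedding.setIntegral_map,
      setIntegral_eq_zero_iff_of_nonneg_ae (Filter.Eventually.of_forall fun z => h0 _) hint] at hz
    -- The parameters of the relative interior: coordinates at vertices outside f vanish
    -- automatically on the affine hull, so strict positivity at the vertices of f is an open
    -- condition.
    let U : Set V := ⋂ v ∈ f, {z | 0 < bary T v (ι z)}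
    have hU : IsOpen U := isOpen_biInter_finset fun v _ =>
      isOpen_lt continuous_const ((continuous_bary T v).comp hι.continuous)
    have hUK : U ⊆ ι ⁻¹' hull f := fun z hz => by
      refine relInt_subset_hull hT hf ⟨fun v hv => Set.mem_iInter₂.1 hz v hv, fun v hv hvf => ?_⟩
      classical
      rw [bary_add, baryDir_of_mem_vectorSpan hT hf hv hvf z.2, bary_apply hT (hf hx₀) hv, if_neg,
        add_zero]
      rintro rfl; exact hvf hx₀
    have h1 := Measure.eqOn_open_of_ae_eq (ae_restrict_of_ae_restrict_of_subset hUK hz) hU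
      (hg.comp hι.continuous).continuousOn continuousOn_const
    obtain ⟨z, rfl⟩ := hr (relInt_subset_hull hT hf hx)
    exact h1 (Set.mem_iInter₂.2 hx.1)

theorem integrableOn_hull (hT : IsSimplex T) (hf : f ⊆ T) (hne : f.Nonempty)
    {g : E n → ℝ} (hg : Continuous g) :
    IntegrableOn g (hull f) (Measure.euclideanHausdorffMeasure (dim f)) :=
  (integrableOn_hull_and_eq_zero hT hf hne hg).1

/-- The moment of a polynomial over a sub-simplex, as a linear functional. -/
theorem exists_moment (hT : IsSimplex T) (hf : f ⊆ T) (hne : f.Nonempty) (a : E n →₀ ℕ) :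
    ∃ φ : MvPolynomial (Fin n) ℝ →ₗ[ℝ] ℝ, ∀ Q, φ Q = ∫ x in hull f, polyFun Q x * bernstein T a x
      ∂(Measure.euclideanHausdorffMeasure (dim f)) := by
  have hc : ∀ Q : MvPolynomial (Fin n) ℝ, Continuous fun x => polyFun Q x * bernstein T a x := by
    intro Q
    simp_rw [← polyFun_bernPoly]
    exact (continuous_polyFun Q).mul (continuous_polyFun _)
  let φ : MvPolynomial (Fin n) ℝ → ℝ := fun Q =>
    ∫ x in hull f, polyFun Q x * bernstein T a x ∂(Measure.euclideanHausdorffMeasure (dim f))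
  have hadd : ∀ P Q, φ (P + Q) = φ P + φ Q := fun P Q => by
    simp only [φ, polyFun_add, add_mul]
    exact integral_add (integrableOn_hull hT hf hne (hc P)) (integrableOn_hull hT hf hne (hc Q))
  have hsmul : ∀ (c : ℝ) Q, φ (c • Q) = c • φ Q := fun c Q => by
    simp only [φ, polyFun_smul, mul_assoc, smul_eq_mul]
    exact integral_const_mul _ _
  exact ⟨⟨⟨φ, hadd⟩, hsmul⟩, fun Q => rfl⟩

/-! ### Linear independence of Bernstein polynomials -/

/-- By homogeneity: a positive vector y, divided by its sum σ over f, gives the barycentric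
coordinates of a point of the relative interior. There the Bernstein sum is σ^(-N) times ∑ c_a y^a,
so this polynomial vanishes on the positive orthant and is zero. -/
theorem eq_zero_of_forall_relInt (hT : IsSimplex T) (hf : f ⊆ T) (hne : f.Nonempty) {N : ℕ}
    (A : Finset (E n →₀ ℕ)) (hA : ∀ a ∈ A, a.support ⊆ f ∧ ∑ v ∈ f, a v = N)
    (c : (E n →₀ ℕ) → ℝ) (h : ∀ x ∈ relInt T f, ∑ a ∈ A, c a * bernstein T a x = 0) :
    ∀ a ∈ A, c a = 0 := by
  classical
  let P : MvPolynomial (E n) ℝ := ∑ a ∈ A, MvPolynomial.monomial a (c a)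
  have hP : P = 0 := by
    refine MvPolynomial.funext_set (fun _ => Set.Ioi (0 : ℝ)) (fun _ => Set.Ioi_infinite 0)
      fun y hy => ?_
    have hy0 : ∀ v, 0 < y v := fun v => hy v (Set.mem_univ v)
    set σ := ∑ v ∈ f, y v with hσ
    have hσ0 : 0 < σ := Finset.sum_pos (fun v _ => hy0 v) hne
    have hs : ∑ v ∈ f, y v / σ = 1 := by rw [← Finset.sum_div, div_self hσ0.ne']
    let x : E n := ∑ u ∈ f, (y u / σ) • u
    have hb : ∀ v ∈ T, bary T v x = if v ∈ f then y v / σ else 0 := fun v hv =>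
      bary_of_mem_hull hT hf hs hv
    have hx := h x ⟨fun v hv => by rw [hb v (hf hv), if_pos hv]; exact div_pos (hy0 v) hσ0,
      fun v hv hvf => by rw [hb v hv, if_neg hvf]⟩
    have key : MvPolynomial.eval y P = σ ^ N * ∑ a ∈ A, c a * bernstein T a x := by
      rw [map_sum, Finset.mul_sum]
      refine Finset.sum_congr rfl fun a ha => ?_
      rw [MvPolynomial.eval_monomial, bernstein_eq_prod hf (hA a ha).1, mul_left_comm]
      congr 1
      rw [Finsupp.prod_of_support_subset a (hA a ha).1 _ (by simp), ← (hA a ha).2,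
        ← Finset.prod_pow_eq_pow_sum, ← Finset.prod_mul_distrib]
      refine Finset.prod_congr rfl fun v hv => ?_
      rw [hb v (hf hv), if_pos hv, ← mul_pow, mul_div_cancel₀ _ hσ0.ne']
    rw [key, hx, mul_zero, map_zero]
  intro a ha
  have h1 : P.coeff a = 0 := by rw [hP, MvPolynomial.coeff_zero]
  rw [MvPolynomial.coeff_sum] at h1
  simpa [MvPolynomial.coeff_monomial, ha] using h1

open scoped Classical in
theorem sum_add_dist {V : Type*} {T f : Finset V} (hf : f ⊆ T) (α : V →₀ ℕ) :
    ∑ v ∈ f, α v + dist T f α = ∑ v ∈ T, α v := by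
  rw [dist, add_comm, Finset.sum_sdiff hf]

theorem sum_restr {V : Type*} (f : Finset V) (α : V →₀ ℕ) :
    ∑ v ∈ f, restr f α v = ∑ v ∈ f, α v :=
  Finset.sum_congr rfl fun _ hv => restr_apply_of_mem hv α

theorem restr_le {V : Type*} (f : Finset V) (α : V →₀ ℕ) : restr f α ≤ α := fun v => by
  by_cases hv : v ∈ f
  · rw [restr_apply_of_mem hv]
  · rw [restr_apply_of_notMem hv]; exact Nat.zero_le _

theorem eval_monomial_sub_restr {V : Type*} {T f : Finset V} {α : V →₀ ℕ} (hα : α.support ⊆ T)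
    (y : V → ℝ) (c : ℝ) :
    MvPolynomial.eval y (MvPolynomial.monomial (α - restr f α) c) = c * normalCoeff T f α y := by
  classical
  rw [MvPolynomial.eval_monomial, normalCoeff, Finsupp.prod_of_support_subset (s := T \ f)]
  · congr 1
    refine Finset.prod_congr (by congr) fun v hv => ?_
    rw [Finsupp.tsub_apply, restr_apply_of_notMem (Finset.mem_sdiff.1 hv).2, Nat.sub_zero]
  · intro v hv
    rw [Finsupp.mem_support_iff, Finsupp.tsub_apply] at hv
    refine Finset.mem_sdiff.2 ⟨hα (Finsupp.mem_support_iff.2 fun h => hv (by simp [h])), fun h => ?_⟩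
    exact hv (by rw [restr_apply_of_mem h, Nat.sub_self])
  · simp

/-- A homogeneous polynomial in the variables outside `f` is determined by its values. -/
theorem eq_zero_of_sum_normalCoeff {V : Type*} {T f : Finset V} (L : Finset (V →₀ ℕ))
    (hL : ∀ α ∈ L, α.support ⊆ T) {a : V →₀ ℕ} (ha : ∀ α ∈ L, restr f α = a) (c : (V →₀ ℕ) → ℝ)
    (h : ∀ y : V → ℝ, ∑ α ∈ L, c α * normalCoeff T f α y = 0) : ∀ α ∈ L, c α = 0 := by
  classical
  intro α hα
  let P : MvPolynomial V ℝ := ∑ α ∈ L, MvPolynomial.monomial (α - restr f α) (c α)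
  have hP : P = 0 := MvPolynomial.funext fun y => by
    rw [map_zero, ← h y, map_sum]
    exact Finset.sum_congr rfl fun α hα => eval_monomial_sub_restr (hL α hα) y (c α)
  have h1 : P.coeff (α - restr f α) = 0 := by rw [hP, MvPolynomial.coeff_zero]
  rw [MvPolynomial.coeff_sum, Finset.sum_eq_single α] at h1
  · rwa [MvPolynomial.coeff_monomial, if_pos rfl] at h1
  · intro α' hα' hne
    rw [MvPolynomial.coeff_monomial, if_neg]
    -- Distinct nodes give distinct monomials: the part on f is fixed to be `a`, so the part outside
    -- f determines the node.
    intro he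
    apply hne
    rw [← tsub_add_cancel_of_le (restr_le f α'), he, ha α' hα', ← ha α hα,
      tsub_add_cancel_of_le (restr_le f α)]
  · exact fun h => absurd hα h

theorem normalCoeff_congr {V : Type*} {T f : Finset V} {b b' : V → ℝ}
    (h : ∀ v ∈ T, v ∉ f → b v = b' v) (α : V →₀ ℕ) :
    normalCoeff T f α b = normalCoeff T f α b' := by
  classical
  rw [normalCoeff, normalCoeff]
  refine Finset.prod_congr rfl fun v hv => ?_
  obtain ⟨hv1, hv2⟩ : v ∈ T ∧ v ∉ f := by simpa using hv
  rw [h v hv1 hv2]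

/-! ### Vanishing moments force vanishing coefficients -/

/-- The polynomial with Bernstein coefficients `c`. -/
noncomputable def bernSum (T : Finset (E n)) (L : Finset (E n →₀ ℕ)) (c : (E n →₀ ℕ) → ℝ) :
    MvPolynomial (Fin n) ℝ := ∑ α ∈ L, c α • bernPoly T α

-- On f, nodes farther than s contribute nothing to the s-th derivative and nearer ones have zero
-- coefficient, so only leading terms at distance exactly s remain.
open scoped Classical in
theorem polyFun_iterate_dirDeriv_bernSum (hT : IsSimplex T) (hf : f ⊆ T) {s : ℕ}
    (L : Finset (E n →₀ ℕ)) (c : (E n →₀ ℕ) → ℝ) (hc : ∀ α ∈ L, dist T f α < s → c α = 0)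
    (w : E n) {x : E n} (hx : x ∈ hull f) :
    polyFun ((dirDeriv w)^[s] (bernSum T L c)) x = s.factorial *
      ∑ α ∈ L with dist T f α = s,
        c α * normalCoeff T f α (baryDir T · w) * bernstein T (restr f α) x := by
  rw [polyFun_iterate_dirDeriv, bernSum, map_sum, Polynomial.finsetSum_coeff, Finset.sum_filter]
  congr 1
  refine Finset.sum_congr rfl fun α hα => ?_
  rw [map_smul, Polynomial.coeff_smul, smul_eq_mul]
  by_cases h : dist T f α < s
  · rw [hc α hα h, if_neg h.ne, zero_mul]
  · rw [coeff_lineHom_bernPoly hT hf hx w α s (not_lt.1 h)]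
    split_ifs
    · ring
    · simp

/-- The induction step: vanishing moments of the derivatives of order `s` of a polynomial on a
sub-simplex, whose Bernstein coefficients at distance less than `s` vanish, force the coefficients
at distance `s` to vanish. -/
theorem coeff_eq_zero_of_moments (hT : IsSimplex T) (hf : f ⊆ T) (hne : f.Nonempty) {k s d : ℕ}
    (L : Finset (E n →₀ ℕ)) (hL : ∀ α ∈ L, α ∈ lattice k T) (c : (E n →₀ ℕ) → ℝ) (W : Fin d → E n)
    (hW : ∀ y : E n → ℝ, ∃ z : Fin d → ℝ, ∀ v ∈ T, v ∉ f → baryDir T v (∑ i, z i • W i) = y v)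
    (hc : ∀ α ∈ L, dist T f α < s → c α = 0)
    (hmom : ∀ α ∈ L, dist T f α = s → c α ≠ 0 → ∀ β : Fin d → ℕ, ∑ i, β i = s →
      ∫ x in hull f, polyFun (polyMultiDeriv W β (bernSum T L c)) x * bernstein T (restr f α) x
        ∂(Measure.euclideanHausdorffMeasure (dim f)) = 0) :
    ∀ α ∈ L, dist T f α = s → c α = 0 := by
  classical
  -- Nodes with zero coefficient are dropped because no moment hypothesis is available for them: in
  -- the application they may lie in tubes of smaller sub-simplices, outside the piece of f.
  set L' := L.filter fun α => dist T f α = s ∧ c α ≠ 0 with hL'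
  have key : ∀ w : E n, (∃ z : Fin d → ℝ, w = ∑ i, z i • W i) → ∀ a ∈ L'.image (restr f),
      ∑ α ∈ L' with restr f α = a, c α * normalCoeff T f α (baryDir T · w) = 0 := by
    rintro w ⟨z, rfl⟩
    set w := ∑ i, z i • W i with hw
    let P : MvPolynomial (Fin n) ℝ :=
      ∑ α ∈ L', (c α * normalCoeff T f α (baryDir T · w)) • bernPoly T (restr f α)
    have hP : ∀ x ∈ hull f, polyFun ((dirDeriv w)^[s] (bernSum T L c)) x =
        s.factorial * polyFun P x := fun x hx => by
      rw [polyFun_iterate_dirDeriv_bernSum hT hf L c hc w hx]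
      congr 1
      simp only [P, polyFun_sum, polyFun_smul, polyFun_bernPoly]
      rw [hL', ← Finset.filter_filter]
      refine (Finset.sum_filter_of_ne ?_).symm
      rintro α - h0 h1
      exact h0 (by rw [h1, zero_mul, zero_mul])
    have hPi : ∀ Q : MvPolynomial (Fin n) ℝ, IntegrableOn (polyFun Q) (hull f)
        (Measure.euclideanHausdorffMeasure (dim f)) := fun Q =>
      integrableOn_hull hT hf hne (continuous_polyFun Q)
    have hmom' : ∀ α ∈ L', ∫ x in hull f, polyFun (P * bernPoly T (restr f α)) x
        ∂(Measure.euclideanHausdorffMeasure (dim f)) = 0 := fun α hα => by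
      obtain ⟨h1, h2, h3⟩ := Finset.mem_filter.1 hα
      obtain ⟨φ, hφ⟩ := exists_moment hT hf hne (restr f α)
      have h4 := eq_zero_iterate_dirDeriv_of_polyMultiDeriv W z s φ (bernSum T L c)
        fun β hβ => by rw [hφ]; exact hmom α h1 h2 h3 β hβ
      rw [hφ, ← hw] at h4
      have h5 : ∫ x in hull f, (s.factorial : ℝ) * polyFun (P * bernPoly T (restr f α)) x
          ∂(Measure.euclideanHausdorffMeasure (dim f)) = 0 := by
        rw [← h4]
        refine setIntegral_congr_fun (isCompact_hull f).measurableSet fun x hx => ?_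
        simp only [hP x hx, polyFun_mul, polyFun_bernPoly]
        ring
      rw [integral_const_mul] at h5
      exact (mul_eq_zero.1 h5).resolve_left (Nat.cast_ne_zero.2 s.factorial_ne_zero)
    -- `P` is itself a combination of the test functions against which its moments vanish.
    have hsq : ∫ x in hull f, polyFun (P * P) x ∂(Measure.euclideanHausdorffMeasure (dim f)) = 0 := by
      have : ∀ x, polyFun (P * P) x = ∑ α ∈ L', (c α * normalCoeff T f α (baryDir T · w)) *
          polyFun (P * bernPoly T (restr f α)) x := fun x => by
        conv_lhs => rw [polyFun_mul]; arg 2; simp only [P, polyFun_sum, polyFun_smul]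
        rw [Finset.mul_sum]
        exact Finset.sum_congr rfl fun α _ => by rw [polyFun_mul]; ring
      simp_rw [this]
      rw [integral_finsetSum _ fun α _ => (hPi _).const_mul _]
      exact Finset.sum_eq_zero fun α hα => by rw [integral_const_mul, hmom' α hα, mul_zero]
    have hzero : ∀ x ∈ relInt T f, polyFun P x = 0 := fun x hx => by
      have := (integrableOn_hull_and_eq_zero hT hf hne (continuous_polyFun (P * P))).2
        (fun x => by rw [polyFun_mul]; exact mul_self_nonneg _) hsq x hx
      rwa [polyFun_mul, mul_self_eq_zero] at this
    refine eq_zero_of_forall_relInt hT hf hne (N := k - s) (L'.image (restr f)) ?_ _ ?_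
    · intro a ha
      obtain ⟨α, hα, rfl⟩ := Finset.mem_image.1 ha
      obtain ⟨h1, h2, h3⟩ := Finset.mem_filter.1 hα
      refine ⟨support_restr_subset f α, ?_⟩
      have h4 := sum_add_dist hf α
      rw [(hL α h1).2] at h4
      rw [sum_restr]
      omega
    · intro x hx
      rw [← hzero x hx]
      simp only [P, polyFun_sum, polyFun_smul, polyFun_bernPoly]
      rw [← Finset.sum_fiberwise_of_maps_to (t := L'.image (restr f))
        (fun α hα => Finset.mem_image_of_mem _ hα)]
      refine Finset.sum_congr rfl fun a ha => ?_
      rw [Finset.sum_mul]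
      exact Finset.sum_congr rfl fun α hα => by rw [(Finset.mem_filter.1 hα).2]
  intro α hα hs
  by_contra h0
  have hαL : α ∈ L' := Finset.mem_filter.2 ⟨hα, hs, h0⟩
  refine h0 (eq_zero_of_sum_normalCoeff (T := T) (f := f)
    (L'.filter fun α' => restr f α' = restr f α) (fun α' h => ?_)
    (a := restr f α) (fun α' h => (Finset.mem_filter.1 h).2) c (fun y => ?_) α
    (Finset.mem_filter.2 ⟨hαL, rfl⟩))
  · exact (hL α' (Finset.mem_filter.1 (Finset.mem_filter.1 h).1).1).1
  -- For a fixed restriction to f, the relation is a polynomial identity in the derivatives of the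
  -- outer barycentric coordinates; `hW` lets them take arbitrary values.
  · obtain ⟨z, hz⟩ := hW y
    rw [← key _ ⟨z, rfl⟩ _ (Finset.mem_image_of_mem _ hαL)]
    exact Finset.sum_congr rfl fun α' _ => by rw [normalCoeff_congr hz]

end

section

/-! ### Decomposition of the simplicial lattice -/

section Lattice

variable {V : Type*} {n k : ℕ} {r : ℕ → ℕ} {T f g : Finset V}

theorem monotone_bound (hrn : r n = 0) (hr : ∀ ℓ, ℓ + 2 ≤ n → 2 * r (ℓ + 1) ≤ r ℓ) {i j : ℕ}
    (hij : i ≤ j) (hj : j ≤ n) : r j ≤ r i := by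
  induction j, hij using Nat.le_induction with
  | base => exact le_rfl
  | succ j hij ih =>
    refine le_trans ?_ (ih (by omega))
    -- The halving condition ends at r_{n-1}; the last comparison comes from r_n = 0.
    rcases Nat.lt_or_ge (j + 1) n with h | h
    · have := hr j (by omega)
      omega
    · rw [show j + 1 = n by omega, hrn]
      exact Nat.zero_le _

theorem dim_le (hT : T.card = n + 1) (hf : f ∈ subsimplices T) : dim f ≤ n := by
  have := Finset.card_le_card hf.2
  rw [dim]
  omega

theorem dim_lt (hT : T.card = n + 1) (hf : f ∈ subsimplices T) (h : f ≠ T) : dim f < n := by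
  have := Finset.card_lt_card (hf.2.ssubset_of_ne h)
  have := hf.1.card_pos
  rw [dim]
  omega

theorem dim_lt_dim (hf : f.Nonempty) (hfg : f ⊂ g) : dim f < dim g := by
  have := Finset.card_lt_card hfg
  have := hf.card_pos
  rw [dim, dim]
  omega

open scoped Classical in
theorem dist_le_add (T f g : Finset V) (α : V →₀ ℕ) :
    dist T (f ∩ g) α ≤ dist T f α + dist T g α := by
  rw [dist, dist, dist, ← Finset.sum_union_inter]
  refine le_trans (Finset.sum_le_sum_of_subset fun v hv => ?_) (Nat.le_add_right _ _)
  simp only [Finset.mem_sdiff, Finset.mem_inter, Finset.mem_union] at hv ⊢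
  tauto

theorem dist_self (T : Finset V) (α : V →₀ ℕ) : dist T T α = 0 := by
  simp [dist]

/-- Every node of a tube around `f` lies in the piece of some sub-simplex of `f`. -/
theorem exists_mem_piece (hf : f.Nonempty) {α : V →₀ ℕ} (hα : α ∈ tube k T f (r (dim f))) :
    ∃ e ∈ subsimplices f, α ∈ piece k r T e := by
  induction hN : f.card using Nat.strong_induction_on generalizing f with
  | _ N ih =>
    by_cases h : ∃ e ∈ subsimplices f, dim e < dim f ∧ α ∈ tube k T e (r (dim e))
    · obtain ⟨e, he, hd, hα'⟩ := h
      have hc : e.card < N := by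
        have := he.1.card_pos
        rw [dim, dim] at hd
        omega
      obtain ⟨e', he', h'⟩ := ih e.card hc he.1 hα' rfl
      exact ⟨e', ⟨he'.1, he'.2.trans he.2⟩, h'⟩
    · refine ⟨f, ⟨hf, subset_rfl⟩, hα, fun h' => h ?_⟩
      obtain ⟨e, he, hα'⟩ := Set.mem_iUnion₂.1 h'
      exact ⟨e, he.1, he.2, hα'⟩

theorem mem_lattice_iff_exists_piece (hT : T.card = n + 1) {α : V →₀ ℕ} :
    α ∈ lattice k T ↔ ∃ f ∈ subsimplices T, α ∈ piece k r T f := by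
  refine ⟨fun h => exists_mem_piece (Finset.card_pos.1 (by omega)) ⟨h, ?_⟩, ?_⟩
  · rw [dist_self]
    exact Nat.zero_le _
  · rintro ⟨f, -, h⟩
    exact h.1.1

/-- If f ⊆ g, the tube of f was removed from the piece of g. Otherwise g ≠ T, and a common node is
within 2 r_{dim f} of f ∩ g, which is within reach of a tube removed from the piece of f. -/
theorem pairwiseDisjoint_piece (hrn : r n = 0) (hr : ∀ ℓ, ℓ + 2 ≤ n → 2 * r (ℓ + 1) ≤ r ℓ)
    (hk : 2 * r 0 + 1 ≤ k) (hT : T.card = n + 1) :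
    (subsimplices T).PairwiseDisjoint (piece k r T) := by
  classical
  have main : ∀ f ∈ subsimplices T, ∀ g ∈ subsimplices T, f ≠ g → dim f ≤ dim g → ∀ α,
      α ∈ piece k r T f → α ∉ piece k r T g := by
    intro f hf g hg hne hfg α hαf hαg
    by_cases hs : f ⊆ g
    · exact hαg.2 (Set.mem_iUnion₂.2
        ⟨f, ⟨⟨hf.1, hs⟩, dim_lt_dim hf.1 (hs.ssubset_of_ne hne)⟩, hαf.1⟩)
    have hg' : g ≠ T := by
      rintro rfl; exact hs hf.2
    have hd := dim_lt hT hg hg'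
    have h1 : dist T (f ∩ g) α ≤ 2 * r (dim f) := by
      have h2 := dist_le_add T f g α
      have h3 := hαf.1.2
      have h4 := hαg.1.2
      have h5 := monotone_bound hrn hr hfg hd.le
      omega
    -- The distance to the empty set is |α| = k, too large because k > 2 r_0.
    rcases (f ∩ g).eq_empty_or_nonempty with he | he
    · have h2 := sum_add_dist (f := f ∩ g) (Finset.inter_subset_left.trans hf.2) α
      rw [he, Finset.sum_empty, zero_add, hαf.1.1.2] at h2
      rw [he, h2] at h1
      have h3 := monotone_bound hrn hr (Nat.zero_le (dim f)) (hfg.trans hd.le)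
      omega
    · have hsub : f ∩ g ⊂ f := Finset.inter_subset_left.ssubset_of_ne fun h =>
        hs (Finset.inter_eq_left.1 h)
      have hdim := dim_lt_dim he hsub
      refine hαf.2 (Set.mem_iUnion₂.2 ⟨f ∩ g, ⟨⟨he, hsub.1⟩, hdim⟩, hαf.1.1, h1.trans ?_⟩)
      -- Here dim f ≤ dim g < n keeps the index in the range of the halving condition; dim f ≥ 1
      -- because f ∩ g is a nonempty proper subset of f.
      have h2 := hr (dim f - 1) (by omega)
      rw [Nat.sub_add_cancel (by omega)] at h2
      exact h2.trans (monotone_bound hrn hr (by omega) (by omega))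
  intro f hf g hg hne
  refine Set.disjoint_left.2 fun α hαf hαg => ?_
  rcases le_total (dim f) (dim g) with h | h
  · exact main f hf g hg hne h α hαf hαg
  · exact main g hg f hf hne.symm h α hαg hαf

theorem finite_lattice (k : ℕ) (T : Finset V) : (lattice k T).Finite := by
  classical
  refine (Finset.finite_toSet (Finset.finsuppAntidiag T k)).subset fun α hα => ?_
  exact Finset.mem_finsuppAntidiag.2 ⟨hα.2, hα.1⟩

end Lattice

/-! ### The Bernstein basis -/

variable {n : ℕ} {T T' f : Finset (E n)}

/-- The nodes of the simplicial lattice. -/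
noncomputable def nodes (k : ℕ) (T : Finset (E n)) : Finset (E n →₀ ℕ) :=
  (finite_lattice k T).toFinset

theorem mem_nodes {k : ℕ} {α : E n →₀ ℕ} : α ∈ nodes k T ↔ α ∈ lattice k T := by
  simp [nodes]

theorem nonempty_of_isSimplex (hT : IsSimplex T) : T.Nonempty :=
  Finset.card_pos.1 (by rw [hT.2]; exact Nat.succ_pos n)

theorem linearIndependent_bernstein (hT : IsSimplex T) (k : ℕ) :
    LinearIndependent ℝ fun α : lattice k T => bernstein T (α : E n →₀ ℕ) := by
  rw [linearIndependent_iff']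
  intro s c hc α hα
  classical
  let c' : (E n →₀ ℕ) → ℝ := fun α => if h : α ∈ lattice k T then c ⟨α, h⟩ else 0
  have := eq_zero_of_forall_relInt hT subset_rfl (nonempty_of_isSimplex hT) (N := k)
    (s.image Subtype.val) (fun a ha => ?_) c' (fun x _ => ?_) α (Finset.mem_image_of_mem _ hα)
  · simpa [c'] using this
  · obtain ⟨a, -, rfl⟩ := Finset.mem_image.1 ha
    exact a.2
  · rw [Finset.sum_image fun _ _ _ _ h => Subtype.ext h]
    have := congrFun hc x
    simpa [c'] using this

theorem polySpan_mul {i j : ℕ} {p q : E n → ℝ} (hp : p ∈ polySpan T (lattice i T))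
    (hq : q ∈ polySpan T (lattice j T)) : p * q ∈ polySpan T (lattice (i + j) T) := by
  have h1 : p * q ∈ polySpan T (lattice i T) * polySpan T (lattice j T) :=
    Submodule.mul_mem_mul hp hq
  rw [polySpan, polySpan, Submodule.span_mul_span] at h1
  refine Submodule.span_mono ?_ h1
  rintro _ ⟨_, ⟨α, hα, rfl⟩, _, ⟨β, hβ, rfl⟩, rfl⟩
  refine ⟨α + β, ⟨?_, ?_⟩, ?_⟩
  · classical
    exact Finsupp.support_add.trans (Finset.union_subset hα.1 hβ.1)
  · rw [← hα.2, ← hβ.2, ← Finset.sum_add_distrib]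
    rfl
  · ext x
    simp [bernstein, pow_add, Finset.prod_mul_distrib]

theorem sum_smul_bary_mem (T : Finset (E n)) (y : E n → ℝ) :
    (fun x => ∑ v ∈ T, y v * bary T v x) ∈ polySpan T (lattice 1 T) := by
  classical
  have : (fun x => ∑ v ∈ T, y v * bary T v x) =
      ∑ v ∈ T, y v • bernstein T (Finsupp.single v 1) := by
    ext x
    rw [Finset.sum_apply]
    refine Finset.sum_congr rfl fun v hv => ?_
    rw [Pi.smul_apply, smul_eq_mul, bernstein, Finset.prod_eq_single v]
    · simp
    · intro u _ hu
      rw [Finsupp.single_eq_of_ne hu, pow_zero]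
    · exact fun h => absurd hv h
  rw [this]
  refine Submodule.sum_mem _ fun v hv => Submodule.smul_mem _ _ (Submodule.subset_span ⟨_, ⟨?_, ?_⟩, rfl⟩)
  · exact Finsupp.support_single_subset.trans (by simpa using hv)
  · rw [Finset.sum_eq_single v]
    · simp
    · intro u _ hu
      rw [Finsupp.single_eq_of_ne hu]
    · exact fun h => absurd hv h

/-- Both 1 = ∑ λ_v and the coordinate functions x_i = ∑ v_i λ_v are linear in the λ_v; multiplying a
monomial by a power of this 1 makes it homogeneous of degree k. -/
theorem poly_eq_polySpan (hT : IsSimplex T) (k : ℕ) : poly n k = polySpan T (lattice k T) := by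
  have hone : (1 : E n → ℝ) ∈ polySpan T (lattice 1 T) := by
    convert sum_smul_bary_mem T (fun _ => 1) using 1
    ext x
    simp [sum_bary hT]
  have hX : ∀ i : Fin n, (fun x : E n => x i) ∈ polySpan T (lattice 1 T) := fun i => by
    convert sum_smul_bary_mem T (fun v => v i) using 1
    ext x
    conv_lhs => rw [← sum_bary_smul hT x]
    simp [mul_comm]
  have hone0 : (1 : E n → ℝ) ∈ polySpan T (lattice 0 T) :=
    Submodule.subset_span ⟨0, ⟨by simp, by simp⟩, by ext x; simp [bernstein]⟩
  have hpow : ∀ (p : E n → ℝ) (j : ℕ), p ∈ polySpan T (lattice 1 T) →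
      p ^ j ∈ polySpan T (lattice j T) := fun p j hp => by
    induction j with
    | zero => simpa using hone0
    | succ j ih => rw [pow_succ]; exact polySpan_mul ih hp
  apply le_antisymm
  · intro u hu
    obtain ⟨Q, hQ, rfl⟩ := mem_poly.1 hu
    have : polyFun Q = ∑ s ∈ Q.support, Q.coeff s •
        (∏ i, (fun x : E n => x i) ^ s i * 1 ^ (k - ∑ i, s i) : E n → ℝ) := by
      ext x
      rw [polyFun_eq_eval, MvPolynomial.eval_eq']
      simp
    rw [this]
    refine Submodule.sum_mem _ fun s hs => Submodule.smul_mem _ _ ?_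
    have hsk : ∑ i, s i ≤ k := by
      have := (MvPolynomial.le_totalDegree hs).trans hQ
      rwa [Finsupp.sum_fintype _ _ (fun _ => rfl)] at this
    have hprod : ∀ t : Finset (Fin n), (∏ i ∈ t, (fun x : E n => x i) ^ s i : E n → ℝ) ∈
        polySpan T (lattice (∑ i ∈ t, s i) T) := fun t => by
      classical
      induction t using Finset.induction_on with
      | empty => simpa using hone0
      | insert i t hi ih =>
        rw [Finset.prod_insert hi, Finset.sum_insert hi]
        exact polySpan_mul (hpow _ _ (hX i)) ih
    have := polySpan_mul (hprod Finset.univ) (hpow 1 (k - ∑ i, s i) hone)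
    rw [Nat.add_sub_cancel' hsk] at this
    simpa using this
  · refine Submodule.span_le.2 ?_
    rintro _ ⟨α, hα, rfl⟩
    refine mem_poly.2 ⟨bernPoly T α, (totalDegree_bernPoly_le T α).trans hα.2.le, ?_⟩
    ext x
    simp

theorem exists_bernSum (hT : IsSimplex T) {k : ℕ} {u : E n → ℝ} (hu : u ∈ poly n k) :
    ∃ c, polyFun (bernSum T (nodes k T) c) = u := by
  rw [poly_eq_polySpan hT, polySpan, ← (finite_lattice k T).coe_toFinset,
    Submodule.mem_span_image_finset_iff_exists_fun] at hu
  obtain ⟨c, hc⟩ := hu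
  classical
  refine ⟨fun α => if h : α ∈ nodes k T then c ⟨α, h⟩ else 0, ?_⟩
  rw [← hc]
  ext x
  simp only [bernSum, polyFun_sum, polyFun_smul, polyFun_bernPoly, Finset.sum_apply,
    Pi.smul_apply, smul_eq_mul]
  rw [← Finset.sum_attach]
  refine Finset.sum_congr rfl fun α _ => ?_
  rw [dif_pos α.2]
  rfl

/-- The decomposition of the lattice and of the polynomial space. -/
theorem decomposition {k : ℕ} {r : ℕ → ℕ} (hrn : r n = 0)
    (hr : ∀ ℓ, ℓ + 2 ≤ n → 2 * r (ℓ + 1) ≤ r ℓ) (hk : 2 * r 0 + 1 ≤ k) (hT : IsSimplex T) :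
    (subsimplices T).PairwiseDisjoint (piece k r T) ∧
      (⋃ f ∈ subsimplices T, piece k r T f) = lattice k T ∧
      iSupIndep (fun f : subsimplices T => polySpan T (piece k r T f)) ∧
      (⨆ f : subsimplices T, polySpan T (piece k r T f)) = poly n k := by
  have hd := pairwiseDisjoint_piece hrn hr hk hT.2
  have hU : (⋃ f ∈ subsimplices T, piece k r T f) = lattice k T := by
    ext α
    simp only [Set.mem_iUnion₂, mem_lattice_iff_exists_piece (r := r) hT.2, exists_prop]
  refine ⟨hd, hU, fun f => ?_, ?_⟩
  -- Indexing all spans by one linearly independent family turns disjointness of the pieces into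
  -- independence of the subspaces.
  · have key : ∀ S : Set (E n →₀ ℕ), S ⊆ lattice k T → polySpan T S = Submodule.span ℝ
        ((fun α : lattice k T => bernstein T (α : E n →₀ ℕ)) '' (Subtype.val ⁻¹' S)) := by
      intro S hS
      rw [polySpan, ← Function.comp_def (bernstein T), Set.image_comp, Subtype.image_preimage_coe,
        Set.inter_eq_right.2 hS]
    have h1 : (⨆ g, ⨆ (_ : g ≠ f), polySpan T (piece k r T (g : Finset (E n)))) =
        polySpan T (⋃ g : subsimplices T, ⋃ (_ : g ≠ f), piece k r T g) := by
      simp only [polySpan, Set.image_iUnion, Submodule.span_iUnion]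
    rw [h1]
    simp only
    rw [key (piece k r T f) fun α hα => hα.1.1, key]
    · refine (linearIndependent_bernstein hT k).disjoint_span_image (Disjoint.preimage _ ?_)
      simp only [Set.disjoint_iUnion_right]
      exact fun g hg => hd f.2 g.2 fun h => hg (Subtype.ext h.symm)
    · intro α hα
      obtain ⟨g, _, hα'⟩ := Set.mem_iUnion₂.1 hα
      exact hα'.1.1
  · rw [poly_eq_polySpan hT, ← hU]
    simp only [polySpan, Set.image_iUnion, Submodule.span_iUnion, iSup_subtype]

end

section

section Lattice

/-! ### Pieces and multi-indices under change of the simplex -/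

variable {V : Type*} {k : ℕ} {r : ℕ → ℕ} {T T' f e : Finset V}

/-- Membership in a piece of the lattice depends only on the values at the vertices of `f`. -/
theorem mem_piece_of_eqOn (hf : f ⊆ T) (hf' : f ⊆ T') {α α' : V →₀ ℕ} (hα : α ∈ piece k r T f)
    (hα' : α' ∈ lattice k T') (h : ∀ v ∈ f, α v = α' v) : α' ∈ piece k r T' f := by
  have key : ∀ e ⊆ f, dist T e α = dist T' e α' := fun e he => by
    have h1 := sum_add_dist (he.trans hf) α
    have h2 := sum_add_dist (he.trans hf') α'
    rw [hα.1.1.2] at h1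
    rw [hα'.2] at h2
    have h3 : ∑ v ∈ e, α v = ∑ v ∈ e, α' v := Finset.sum_congr rfl fun v hv => h v (he hv)
    omega
  refine ⟨⟨hα', (key f subset_rfl).symm.trans_le hα.1.2⟩, fun h' => hα.2 ?_⟩
  obtain ⟨e, he, he'⟩ := Set.mem_iUnion₂.1 h'
  exact Set.mem_iUnion₂.2 ⟨e, he, hα.1.1, (key e he.1.2).trans_le he'.2⟩

theorem restr_eq_self {α : V →₀ ℕ} (hα : α.support ⊆ f) : restr f α = α := by
  classical
  exact (Finsupp.filter_eq_self_iff _ _).2 fun v hv => hα (Finsupp.mem_support_iff.2 hv)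

/-- A sub-simplex has as many opposite vertices as normal directions. Numbering these vertices turns
orders of normal derivatives into exponents off f. -/
theorem exists_multiIndex_embedding (hf : f ⊆ T) {d : ℕ} (hd : T.card - f.card = d) :
    ∃ p : (Fin d → ℕ) → (V →₀ ℕ), Function.Injective p ∧ ∀ γ, (p γ).support ⊆ T ∧
      (∀ v ∈ f, p γ v = 0) ∧ ∑ v ∈ T, p γ v = ∑ i, γ i := by
  classical
  have hc : (T \ f).card = d := by rw [Finset.card_sdiff_of_subset hf, hd]
  let ι : Fin d ↪ V := ((T \ f).equivFinOfCardEq hc).symm.toEmbedding.trans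
    (Function.Embedding.subtype _)
  have hι : ∀ i, ι i ∈ T \ f := fun i => (((T \ f).equivFinOfCardEq hc).symm i).2
  refine ⟨fun γ => (Finsupp.equivFunOnFinite.symm γ).embDomain ι,
    (Finsupp.embDomain_injective ι).comp (Equiv.injective _), fun γ => ?_⟩
  have hs : ((Finsupp.equivFunOnFinite.symm γ).embDomain ι).support ⊆ T \ f := by
    intro v hv
    rw [Finsupp.support_embDomain, Finset.mem_map] at hv
    obtain ⟨i, -, rfl⟩ := hv
    exact hι i
  refine ⟨hs.trans Finset.sdiff_subset, fun v hv => ?_, ?_⟩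
  · refine Finsupp.notMem_support_iff.1 fun h => ?_
    exact (Finset.mem_sdiff.1 (hs h)).2 hv
  · have h1 := Finsupp.sum_of_support_subset _ (hs.trans Finset.sdiff_subset) (fun _ x => x)
      (fun _ _ => rfl)
    rw [← h1, Finsupp.sum_embDomain, Finsupp.sum_fintype _ _ fun _ => rfl]
    rfl

end Lattice

variable {n : ℕ} {T T' f : Finset (E n)} {k : ℕ} {r : ℕ → ℕ}

/-! ### Degrees of freedom determine Bernstein coefficients -/

/-- The sub-simplex carrying a degree of freedom. -/
def DoF.carrier : DoF n → Finset (E n)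
  | .vertex v _ => {v}
  | .face f _ _ => f
  | .cell T _ => T

/-- Moving from a vertex of f towards a vertex u outside f changes, among the coordinates outside f,
only that of u. -/
theorem exists_baryDir_eq (hT : IsSimplex T) (hf : f ⊆ T) (hne : f.Nonempty) (y : E n → ℝ) :
    ∃ w, ∀ v ∈ T, v ∉ f → baryDir T v w = y v := by
  classical
  obtain ⟨x₀, hx₀⟩ := hne
  refine ⟨∑ u ∈ T, y u • (u - x₀), fun v hv hvf => ?_⟩
  rw [baryDir_sum, Finset.sum_eq_single_of_mem v hv]
  · rw [baryDir_smul, baryDir_sub, bary_apply hT hv hv, bary_apply hT (hf hx₀) hv, if_pos rfl,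
      if_neg (by rintro rfl; exact hvf hx₀), sub_zero, mul_one]
  · intro u hu huv
    rw [baryDir_smul, baryDir_sub, bary_apply hT hu hv, bary_apply hT (hf hx₀) hv, if_neg huv.symm,
      if_neg (by rintro rfl; exact hvf hx₀), sub_zero, mul_zero]

/-- The component of a direction tangential to f does not affect the coordinates outside f, so its
normal component already realises the prescribed values. -/
theorem exists_baryDir_normalFrame (hT : IsSimplex T) (hf : f ⊆ T) (hne : f.Nonempty)
    {W : Fin (n + 1 - f.card) → E n} (hW : IsNormalFrame f W) (y : E n → ℝ) :
    ∃ z : Fin (n + 1 - f.card) → ℝ, ∀ v ∈ T, v ∉ f → baryDir T v (∑ i, z i • W i) = y v := by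
  obtain ⟨w, hw⟩ := exists_baryDir_eq hT hf hne y
  obtain ⟨p, hp, q, hq, rfl⟩ :=
    (vectorSpan ℝ (f : Set (E n))).exists_add_mem_mem_orthogonal w
  rw [← hW.2, Submodule.mem_span_range_iff_exists_fun] at hq
  obtain ⟨z, rfl⟩ := hq
  refine ⟨z, fun v hv hvf => ?_⟩
  rw [← hw v hv hvf, baryDir_add, baryDir_of_mem_vectorSpan hT hf hv hvf hp, zero_add]

/-- Double induction: over sub-simplices, and for each of them over the distance s. Since only DoFs
carried inside f enter, f = T gives unisolvence and f = T ∩ T' gives conformity. -/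
theorem coeff_eq_zero_of_dofs (hrn : r n = 0) (hT : IsSimplex T)
    {ν : (f : Finset (E n)) → Fin (n + 1 - f.card) → E n}
    (hν : ∀ f ∈ subsimplices T, 1 ≤ dim f → dim f < n → IsNormalFrame f (ν f))
    (c : (E n →₀ ℕ) → ℝ) (hf : f ∈ subsimplices T)
    (h : ∀ d ∈ localDoFs k r T, d.carrier ⊆ f →
      dofValue ν T (polyFun (bernSum T (nodes k T) c)) d = 0) :
    ∀ α ∈ tube k T f (r (dim f)), c α = 0 := by
  classical
  induction f using Finset.strongInduction with
  | H f ih =>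
    have ih' : ∀ e ∈ subsimplices f, dim e < dim f → ∀ α ∈ tube k T e (r (dim e)), c α = 0 :=
      fun e he hd => ih e (he.2.ssubset_of_ne fun h => by rw [h] at hd; exact hd.false)
        ⟨he.1, he.2.trans hf.2⟩ fun d hd hde => h d hd (hde.trans he.2)
    have hpiece : ∀ α ∈ nodes k T, dist T f α ≤ r (dim f) → c α ≠ 0 → α ∈ piece k r T f := by
      intro α hα hd h0
      refine ⟨⟨mem_nodes.1 hα, hd⟩, fun h' => ?_⟩
      obtain ⟨e, he, he'⟩ := Set.mem_iUnion₂.1 h'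
      exact h0 (ih' e he.1 he.2 α he')
    set Q := bernSum T (nodes k T) c with hQ
    have main : ∀ s ≤ r (dim f), ∀ α ∈ nodes k T, dist T f α = s → c α = 0 := by
      intro s
      induction s using Nat.strong_induction_on with
      | _ s ihs =>
        intro hs
        have hc : ∀ α ∈ nodes k T, dist T f α < s → c α = 0 := fun α hα hd =>
          ihs _ hd (hd.le.trans hs) α hα rfl
        have hL : ∀ α ∈ nodes k T, α ∈ lattice k T := fun α => mem_nodes.1
        rcases Nat.eq_zero_or_pos (dim f) with hd0 | hd0
        · obtain ⟨v, rfl⟩ : ∃ v, f = {v} := by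
            rw [← Finset.card_eq_one]
            have := hf.1.card_pos
            rw [dim] at hd0
            omega
          refine coeff_eq_zero_of_moments hT hf.2 hf.1 (nodes k T) hL c
            (fun i => EuclideanSpace.single i (1 : ℝ)) (fun y => ?_) hc fun α hα hds h0 β hβ => ?_
          · obtain ⟨w, hw⟩ := exists_baryDir_eq hT hf.2 hf.1 y
            exact ⟨fun i => w i, by rwa [sum_smul_single]⟩
          · have hdof : DoF.vertex v β ∈ localDoFs k r T :=
              ⟨hf.2 (Finset.mem_singleton_self v), by rw [hβ, ← hd0]; exact hs⟩
            have := h _ hdof subset_rfl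
            rw [dofValue_congr hT (fun _ _ => rfl) hdof] at this
            -- A vertex value is treated as a moment over a point; the mass of the point is
            -- irrelevant because the derivative is zero.
            rw [show hull {v} = {v} by simp [hull], integral_singleton]
            simp only at this
            rw [this, zero_mul, smul_zero]
        · rcases Nat.lt_or_ge (dim f) n with hdn | hdn
          · refine coeff_eq_zero_of_moments hT hf.2 hf.1 (nodes k T) hL c (ν f)
              (exists_baryDir_normalFrame hT hf.2 hf.1 (hν f hf hd0 hdn)) hc
              fun α hα hds h0 β hβ => ?_
            have hdof : DoF.face f (restr f α) β ∈ localDoFs k r T := by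
              refine ⟨hf, hd0, hdn, hβ.trans_le hs, α, hpiece α hα (hds.trans_le hs) h0, ?_, ?_⟩
              · rw [restr]
                congr
              · rw [hβ, ← hds, sum_add_dist hf.2, (hL α hα).2]
            have := h _ hdof subset_rfl
            rwa [dofValue_congr hT (fun _ _ => rfl) hdof] at this
          · obtain rfl : f = T := by
              by_contra hne
              exact (dim_lt hT.2 hf hne).not_ge hdn
            have hdim : dim f = n := le_antisymm (dim_le hT.2 hf) hdn
            obtain rfl : s = 0 := by
              rw [hdim, hrn] at hs
              exact Nat.le_zero.1 hs
            -- For the cell itself there is no vertex outside and r_n = 0 leaves only s = 0, so an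
            -- empty frame suffices.
            refine coeff_eq_zero_of_moments (d := 0) hT hf.2 hf.1 (nodes k f) hL c Fin.elim0
              (fun y => ⟨0, fun v hv hvf => absurd hv hvf⟩) hc fun α hα hds h0 β hβ => ?_
            have hdof : DoF.cell f α ∈ localDoFs k r f :=
              ⟨rfl, hpiece α hα (hds.trans_le hs) h0⟩
            have := h _ hdof subset_rfl
            rw [dofValue_congr hT (fun _ _ => rfl) hdof] at this
            rw [hdim, EuclideanSpace.euclideanHausdorffMeasure_eq_volume,
              restr_eq_self (hL α hα).1]
            exact this
    exact fun α hα => main _ hα.2 α (mem_nodes.2 hα.1) rfl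

/-! ### Counting degrees of freedom -/

/-- Each DoF is sent to a node in the piece of its carrier: the derivative order is spread over the
opposite vertices, the remaining mass sits on the carrier. Disjoint pieces recover the carrier, and
the numbering recovers the rest. -/
theorem exists_injective_localDoFs (hn : 1 ≤ n) (hrn : r n = 0)
    (hr : ∀ ℓ, ℓ + 2 ≤ n → 2 * r (ℓ + 1) ≤ r ℓ) (hk : 2 * r 0 + 1 ≤ k) (hT : IsSimplex T) :
    ∃ F : localDoFs k r T → lattice k T, Function.Injective F := by
  classical
  have hp : ∀ f : Finset (E n), ∃ p : (Fin (n + 1 - f.card) → ℕ) → (E n →₀ ℕ), f ⊆ T →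
      Function.Injective p ∧ ∀ γ, (p γ).support ⊆ T ∧
        (∀ v ∈ f, p γ v = 0) ∧ ∑ v ∈ T, p γ v = ∑ i, γ i := fun f => by
    by_cases hf : f ⊆ T
    · obtain ⟨p, h⟩ := exists_multiIndex_embedding hf (d := n + 1 - f.card) (by rw [hT.2])
      exact ⟨p, fun _ => h⟩
    · exact ⟨fun _ => 0, fun h => absurd h hf⟩
  have hq : ∀ v : E n, ∃ p : (Fin n → ℕ) → (E n →₀ ℕ), v ∈ T →
      Function.Injective p ∧ ∀ γ, (p γ).support ⊆ T ∧
        p γ v = 0 ∧ ∑ v ∈ T, p γ v = ∑ i, γ i := fun v => by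
    by_cases hv : v ∈ T
    · obtain ⟨p, h1, h2⟩ := exists_multiIndex_embedding (f := {v}) (T := T) (by simpa using hv)
        (d := n) (by rw [hT.2]; simp)
      exact ⟨p, fun _ => ⟨h1, fun γ => ⟨(h2 γ).1, (h2 γ).2.1 v (Finset.mem_singleton_self v),
        (h2 γ).2.2⟩⟩⟩
    · exact ⟨fun _ => 0, fun h => absurd h hv⟩
  choose p hp using hp
  choose q hq using hq
  let F : DoF n → (E n →₀ ℕ)
    | .vertex v α => q v α + Finsupp.single v (k - ∑ i, α i)
    | .face f a β => a + p f β
    | .cell _ α => α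
  have hvF : ∀ v α, v ∈ T → F (.vertex v α) v = k - ∑ i, α i := fun v α hv => by
    simp [F, ((hq v hv).2 α).2.1]
  have hcar : ∀ d ∈ localDoFs k r T, d.carrier ∈ subsimplices T := by
    rintro (⟨v, α⟩ | ⟨f, a, β⟩ | ⟨T', α⟩) hd
    · exact ⟨Finset.singleton_nonempty v, by simpa [DoF.carrier] using hd.1⟩
    · exact hd.1
    · exact ⟨by rw [hd.1]; exact nonempty_of_isSimplex hT, by rw [DoF.carrier, hd.1]⟩
  have hF : ∀ d ∈ localDoFs k r T, F d ∈ piece k r T d.carrier := by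
    rintro (⟨v, α⟩ | ⟨f, a, β⟩ | ⟨T', α⟩) hd
    · have hv := hd.1
      have hd2 := hd.2
      obtain ⟨h1, h2, h3⟩ := (hq v hv).2 α
      have hsum : ∑ u ∈ T, F (.vertex v α) u = k := by
        simp only [F, Finsupp.add_apply, Finset.sum_add_distrib, h3]
        rw [Finset.sum_eq_single_of_mem v hv fun u _ hu => Finsupp.single_eq_of_ne hu,
          Finsupp.single_eq_same]
        omega
      refine ⟨⟨⟨?_, hsum⟩, ?_⟩, fun h => ?_⟩
      · refine Finsupp.support_add.trans (Finset.union_subset h1 ?_)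
        exact Finsupp.support_single_subset.trans (by simpa using hv)
      · have h4 := sum_add_dist (f := {v}) (T := T) (by simpa using hv) (F (.vertex v α))
        rw [hsum, Finset.sum_singleton, hvF v α hv] at h4
        simp only [DoF.carrier, dim, Finset.card_singleton, Nat.sub_self]
        omega
      · obtain ⟨e, he, -⟩ := Set.mem_iUnion₂.1 h
        have := he.2
        simp [DoF.carrier, dim] at this
    · obtain ⟨hf, -, -, -, α, hα, rfl, hs⟩ := hd
      obtain ⟨h1, h2, h3⟩ := (hp f hf.2).2 β
      have hval : ∀ v ∈ f, α v = (α.filter (· ∈ f) + p f β) v := fun v hv => by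
        rw [Finsupp.add_apply, h2 v hv, add_zero, Finsupp.filter_apply_pos (· ∈ f) α hv]
      refine mem_piece_of_eqOn hf.2 hf.2 hα ⟨?_, ?_⟩ hval
      · refine Finsupp.support_add.trans (Finset.union_subset ?_ h1)
        rw [Finsupp.support_filter]
        exact (Finset.filter_subset _ _).trans hα.1.1.1
      · simp only [F, Finsupp.add_apply, Finset.sum_add_distrib, h3]
        rw [← hs]
        congr 1
        rw [← Finset.sum_subset hf.2 fun v _ hv => Finsupp.filter_apply_neg (· ∈ f) α hv]
        exact Finset.sum_congr rfl fun v hv => Finsupp.filter_apply_pos (· ∈ f) α hv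
    · obtain ⟨rfl, hα⟩ := hd
      exact hα
  refine ⟨fun d => ⟨F d, (hF d d.2).1.1⟩, ?_⟩
  rintro ⟨d, hd⟩ ⟨d', hd'⟩ hdd
  have hFF : F d = F d' := congrArg Subtype.val hdd
  refine Subtype.ext ?_
  change d = d'
  have hc : d.carrier = d'.carrier := by
    by_contra hne
    refine Set.disjoint_left.1
      (pairwiseDisjoint_piece hrn hr hk hT.2 (hcar d hd) (hcar d' hd') hne) (hF d hd) ?_
    rw [hFF]
    exact hF d' hd'
  have hTc := hT.2
  have hvf : ∀ {v : E n} {α f a β}, DoF.vertex v α ∈ localDoFs k r T →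
      DoF.face f a β ∈ localDoFs k r T → {v} ≠ f := by
    rintro v α f a β - h2 rfl
    have := h2.2.1
    simp [dim] at this
  have hvc : ∀ {v : E n} {T' α}, DoF.cell T' α ∈ localDoFs k r T → {v} ≠ T' := by
    rintro v T' α h2 rfl
    rw [← h2.1] at hTc
    simp at hTc
    omega
  have hfc : ∀ {f : Finset (E n)} {a β T' α}, DoF.face f a β ∈ localDoFs k r T →
      DoF.cell T' α ∈ localDoFs k r T → f ≠ T' := by
    rintro f a β T' α h1 h2 rfl
    have := h1.2.2.1
    rw [h2.1, dim] at this
    omega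
  rcases d with ⟨v, α⟩ | ⟨f, a, β⟩ | ⟨S, α⟩ <;> rcases d' with ⟨v', α'⟩ | ⟨f', a', β'⟩ | ⟨S', α'⟩
  · obtain rfl : v = v' := Finset.singleton_injective hc
    have hv := hd.1
    congr 1
    refine (hq v hv).1 (Finsupp.ext fun u => ?_)
    by_cases hu : u = v
    · rw [hu, ((hq v hv).2 α).2.1, ((hq v hv).2 α').2.1]
    · have := DFunLike.congr_fun hFF u
      simpa [F, Finsupp.single_eq_of_ne hu] using this
  · exact absurd hc (hvf hd hd')
  · exact absurd hc (hvc hd')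
  · exact absurd hc.symm (hvf hd' hd)
  · obtain rfl : f = f' := hc
    obtain ⟨hf, -, -, -, α, -, rfl, -⟩ := hd
    obtain ⟨-, -, -, -, α', -, rfl, -⟩ := hd'
    have hfil : α.filter (· ∈ f) = α'.filter (· ∈ f) := Finsupp.ext fun u => by
      by_cases hu : u ∈ f
      · have := DFunLike.congr_fun hFF u
        simpa only [F, Finsupp.add_apply, ((hp f hf.2).2 β).2.1 u hu,
          ((hp f hf.2).2 β').2.1 u hu, add_zero] using this
      · rw [Finsupp.filter_apply_neg (· ∈ f) α hu, Finsupp.filter_apply_neg (· ∈ f) α' hu]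
    have hβ : p f β = p f β' := by
      have : α.filter (· ∈ f) + p f β = α'.filter (· ∈ f) + p f β' := by
        convert hFF
      rw [hfil] at this
      exact add_left_cancel this
    rw [(hp f hf.2).1 hβ]
    congr
  · exact absurd hc (hfc hd hd')
  · exact absurd hc.symm (hvc hd)
  · exact absurd hc.symm (hfc hd' hd)
  · obtain ⟨rfl, -⟩ := hd
    obtain ⟨rfl, -⟩ := hd'
    congr 1

end

section

variable {n : ℕ} {T T' f : Finset (E n)} {k : ℕ} {r : ℕ → ℕ}
  {ν : (f : Finset (E n)) → Fin (n + 1 - f.card) → E n}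

/-! ### Unisolvence on a simplex -/

theorem mem_subsimplices_self (hT : IsSimplex T) : T ∈ subsimplices T :=
  ⟨nonempty_of_isSimplex hT, subset_rfl⟩

/-- Degrees of freedom as linear functionals on polynomials. -/
theorem exists_dofFunctional (ν : (f : Finset (E n)) → Fin (n + 1 - f.card) → E n)
    (hT : IsSimplex T) {d : DoF n} (hd : d ∈ localDoFs k r T) :
    ∃ φ : MvPolynomial (Fin n) ℝ →ₗ[ℝ] ℝ, ∀ (u : E n → ℝ) (Q : MvPolynomial (Fin n) ℝ),
      Set.EqOn u (polyFun Q) (hull T) → dofValue ν T u d = φ Q := by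
  rcases d with ⟨v, α⟩ | ⟨f, a, β⟩ | ⟨T', α⟩
  · obtain ⟨L, hL⟩ := polyMultiDeriv_linear (fun i : Fin n => EuclideanSpace.single i (1 : ℝ)) α
    refine ⟨(MvPolynomial.aeval (R := ℝ) fun i => v i).toLinearMap ∘ₗ L, fun u Q h => ?_⟩
    rw [dofValue_congr hT h hd, LinearMap.comp_apply, hL]
    rfl
  · obtain ⟨L, hL⟩ := polyMultiDeriv_linear (ν f) β
    obtain ⟨φ, hφ⟩ := exists_moment hT hd.1.2 hd.1.1 a
    refine ⟨φ ∘ₗ L, fun u Q h => ?_⟩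
    rw [dofValue_congr hT h hd, LinearMap.comp_apply, hφ, hL]
  · obtain ⟨φ, hφ⟩ := exists_moment hT subset_rfl (nonempty_of_isSimplex hT) α
    refine ⟨φ, fun u Q h => ?_⟩
    have hdim : dim T = n := by rw [dim, hT.2, Nat.add_sub_cancel]
    rw [dofValue_congr hT h hd, hφ, hdim, EuclideanSpace.euclideanHausdorffMeasure_eq_volume]

theorem dofValue_add (hT : IsSimplex T) {d : DoF n} (hd : d ∈ localDoFs k r T) {u v : E n → ℝ}
    {P Q : MvPolynomial (Fin n) ℝ} (hu : Set.EqOn u (polyFun P) (hull T))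
    (hv : Set.EqOn v (polyFun Q) (hull T)) :
    dofValue ν T (u + v) d = dofValue ν T u d + dofValue ν T v d := by
  obtain ⟨φ, hφ⟩ := exists_dofFunctional ν hT hd
  rw [hφ _ _ hu, hφ _ _ hv, ← map_add]
  exact hφ _ _ fun x hx => by rw [Pi.add_apply, polyFun_add, hu hx, hv hx]

theorem dofValue_smul (hT : IsSimplex T) {d : DoF n} (hd : d ∈ localDoFs k r T) {u : E n → ℝ}
    {P : MvPolynomial (Fin n) ℝ} (hu : Set.EqOn u (polyFun P) (hull T)) (c : ℝ) :
    dofValue ν T (c • u) d = c * dofValue ν T u d := by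
  obtain ⟨φ, hφ⟩ := exists_dofFunctional ν hT hd
  rw [hφ _ _ hu, ← smul_eq_mul, ← map_smul]
  exact hφ _ _ fun x hx => by rw [Pi.smul_apply, polyFun_smul, hu hx, smul_eq_mul]

/-- Vanishing DoFs kill every coefficient, since the tube of T is the whole lattice. Injectivity
bounds dim P_k by the number of DoFs, which is at most the number of nodes, that is dim P_k. -/
theorem unisolvence (hn : 1 ≤ n) (hrn : r n = 0)
    (hr : ∀ ℓ, ℓ + 2 ≤ n → 2 * r (ℓ + 1) ≤ r ℓ) (hk : 2 * r 0 + 1 ≤ k) (hT : IsSimplex T)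
    (hν : ∀ f ∈ subsimplices T, 1 ≤ dim f → dim f < n → IsNormalFrame f (ν f)) :
    ∃ Φ : poly n k ≃ₗ[ℝ] (localDoFs k r T → ℝ),
      ∀ (u : poly n k) (d : localDoFs k r T), Φ u d = dofValue ν T u d := by
  have hpoly : ∀ u : poly n k, ∃ Q : MvPolynomial (Fin n) ℝ,
      Set.EqOn (u : E n → ℝ) (polyFun Q) (hull T) := fun u => by
    obtain ⟨Q, -, hQ⟩ := mem_poly.1 u.2
    exact ⟨Q, fun x _ => by rw [hQ]⟩
  let Ψ : poly n k →ₗ[ℝ] (localDoFs k r T → ℝ) :=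
    { toFun := fun u d => dofValue ν T u d
      map_add' := fun u v => funext fun d => by
        obtain ⟨P, hP⟩ := hpoly u
        obtain ⟨Q, hQ⟩ := hpoly v
        exact dofValue_add hT d.2 hP hQ
      map_smul' := fun c u => funext fun d => by
        obtain ⟨P, hP⟩ := hpoly u
        exact dofValue_smul hT d.2 hP c }
  have hinj : Function.Injective Ψ := by
    rw [← LinearMap.ker_eq_bot, LinearMap.ker_eq_bot']
    intro u hu
    obtain ⟨c, hc⟩ := exists_bernSum hT u.2
    have h0 := coeff_eq_zero_of_dofs (k := k) hrn hT hν c (mem_subsimplices_self hT)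
      fun d hd _ => by rw [hc]; exact congrFun hu ⟨d, hd⟩
    refine Subtype.ext ?_
    rw [← hc, bernSum, Finset.sum_eq_zero fun α hα => ?_]
    · exact funext polyFun_zero
    · rw [h0 α ⟨mem_nodes.1 hα, by rw [dist_self]; exact Nat.zero_le _⟩, zero_smul]
  obtain ⟨F, hF⟩ := exists_injective_localDoFs hn hrn hr hk hT
  have : Finite (lattice k T) := finite_lattice k T
  have : Finite (localDoFs k r T) := Finite.of_injective F hF
  have := Fintype.ofFinite (lattice k T)
  have := Fintype.ofFinite (localDoFs k r T)
  have hspan : poly n k =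
      Submodule.span ℝ (Set.range fun α : lattice k T => bernstein T (α : E n →₀ ℕ)) := by
    rw [poly_eq_polySpan hT, polySpan, Set.image_eq_range]
  have hdim : Module.finrank ℝ (poly n k) = Fintype.card (lattice k T) := by
    rw [hspan]
    exact finrank_span_eq_card (linearIndependent_bernstein hT k)
  have : FiniteDimensional ℝ (poly n k) := FiniteDimensional.of_injective Ψ hinj
  have hle := LinearMap.finrank_le_finrank_of_injective hinj
  have hge := Fintype.card_le_of_injective F hF
  rw [Module.finrank_fintype_fun_eq_card] at hle
  have heq : Module.finrank ℝ (poly n k) = Module.finrank ℝ (localDoFs k r T → ℝ) := by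
    rw [Module.finrank_fintype_fun_eq_card]
    omega
  exact ⟨LinearEquiv.ofInjectiveOfFinrankEq Ψ hinj heq, fun u d => rfl⟩

/-! ### Degrees of freedom shared by two simplices -/

/-- Piece membership sees only the values on the carrier, so DoFs on a common sub-simplex belong to
both cells. The hypothesis on `T` excludes interior moments. -/
theorem mem_localDoFs_of_carrier_subset (hT' : IsSimplex T') (hf' : f ⊆ T') (hfT : ¬ T ⊆ f)
    {d : DoF n} (hd : d ∈ localDoFs k r T) (hdf : d.carrier ⊆ f) : d ∈ localDoFs k r T' := by
  classical
  rcases d with ⟨v, α⟩ | ⟨e, a, β⟩ | ⟨S, α⟩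
  · exact ⟨hf' (hdf (Finset.mem_singleton_self v)), hd.2⟩
  · obtain ⟨he, h1, h2, h3, α, hα, ha, hs⟩ := hd
    have heT' : e ⊆ T' := Finset.Subset.trans hdf hf'
    refine ⟨⟨he.1, heT'⟩, h1, h2, h3, ?_⟩
    obtain ⟨w, hw, hwe⟩ : ∃ w ∈ T', w ∉ e := by
      by_contra! h
      have := Finset.card_le_card (show T' ⊆ e from h)
      have := hT'.2
      rw [dim] at h2
      omega
    -- The mass off e is moved to one vertex of `T'` outside e, which exists because dim e < n.
    let α' : E n →₀ ℕ := restr e α + Finsupp.single w (∑ i, β i)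
    have hval : ∀ v ∈ e, α v = α' v := fun v hv => by
      rw [Finsupp.add_apply, restr_apply_of_mem hv,
        Finsupp.single_eq_of_ne (by rintro rfl; exact hwe hv), add_zero]
    have hlat : α' ∈ lattice k T' := by
      constructor
      · refine Finsupp.support_add.trans (Finset.union_subset
          ((support_restr_subset e α).trans heT') ?_)
        exact Finsupp.support_single_subset.trans (by simpa using hw)
      · simp only [α', Finsupp.add_apply, Finset.sum_add_distrib]
        rw [Finset.sum_eq_single_of_mem w hw fun u _ hu => Finsupp.single_eq_of_ne hu,
          Finsupp.single_eq_same,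
          ← Finset.sum_subset heT' fun v _ hv => restr_apply_of_notMem hv α, sum_restr, hs]
    refine ⟨α', mem_piece_of_eqOn he.2 heT' hα hlat hval, ?_, ?_⟩
    · rw [ha]
      ext v
      by_cases hv : v ∈ e
      · rw [Finsupp.filter_apply_pos (· ∈ e) _ hv, Finsupp.filter_apply_pos (· ∈ e) _ hv, hval v hv]
      · rw [Finsupp.filter_apply_neg (· ∈ e) _ hv, Finsupp.filter_apply_neg (· ∈ e) _ hv]
    · rw [← hs, Finset.sum_congr rfl hval]
  · exact absurd (hd.1 ▸ hdf) hfT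

theorem dofValue_eq_of_carrier_subset (hT : IsSimplex T) (hT' : IsSimplex T') (hf : f ⊆ T)
    (hf' : f ⊆ T') (hfT : ¬ T ⊆ f) {d : DoF n} (hd : d ∈ localDoFs k r T) (hdf : d.carrier ⊆ f)
    (Q : MvPolynomial (Fin n) ℝ) :
    dofValue ν T (polyFun Q) d = dofValue ν T' (polyFun Q) d := by
  classical
  have hd' := mem_localDoFs_of_carrier_subset hT' hf' hfT hd hdf
  rw [dofValue_congr hT (fun _ _ => rfl) hd, dofValue_congr hT' (fun _ _ => rfl) hd']
  rcases d with ⟨v, α⟩ | ⟨e, a, β⟩ | ⟨S, α⟩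
  · rfl
  · refine setIntegral_congr_fun (isCompact_hull e).measurableSet fun x hx => ?_
    obtain ⟨he, -, -, -, α, -, ha, -⟩ := hd
    have has : a.support ⊆ e := by
      rw [ha, Finsupp.support_filter]
      intro v hv
      exact (Finset.mem_filter.1 hv).2
    simp only [bernstein_congr hT hT' (Finset.Subset.trans hdf hf) (Finset.Subset.trans hdf hf')
      has hx]
  · exact absurd (hd.1 ▸ hdf) hfT

/-! ### Vanishing of derivatives on a sub-simplex -/

/-- All iterated directional derivatives of `Q` of order at most `m` vanish on `S`. -/
def VanishesTo (S : Set (E n)) : ℕ → MvPolynomial (Fin n) ℝ → Prop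
  | 0, Q => ∀ x ∈ S, polyFun Q x = 0
  | m + 1, Q => (∀ x ∈ S, polyFun Q x = 0) ∧ ∀ w, VanishesTo S m (dirDeriv w Q)

theorem VanishesTo.eq_zero {S : Set (E n)} {m : ℕ} {Q : MvPolynomial (Fin n) ℝ}
    (h : VanishesTo S m Q) : ∀ x ∈ S, polyFun Q x = 0 := by
  cases m with
  | zero => exact h
  | succ m => exact h.1

theorem vanishesTo_zero (S : Set (E n)) (m : ℕ) : VanishesTo S m 0 := by
  induction m with
  | zero => exact fun x _ => polyFun_zero x
  | succ m ih => exact ⟨fun x _ => polyFun_zero x, fun w => by rwa [map_zero]⟩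

theorem vanishesTo_empty (m : ℕ) (Q : MvPolynomial (Fin n) ℝ) : VanishesTo ∅ m Q := by
  induction m generalizing Q with
  | zero => exact fun x hx => hx.elim
  | succ m ih => exact ⟨fun x hx => hx.elim, fun w => ih _⟩

/-- The ideal generated by the barycentric coordinates of `T` vanishing on `f`. -/
noncomputable def faceIdeal (T f : Finset (E n)) : Ideal (MvPolynomial (Fin n) ℝ) :=
  Ideal.span {Q | ∃ v ∈ T, v ∉ f ∧ Q = baryPoly T v}

/-- Leibniz rule: one derivative lowers the order of vanishing by at most one. -/
theorem dirDeriv_mem_pow (I : Ideal (MvPolynomial (Fin n) ℝ)) (w : E n) {m : ℕ}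
    {Q : MvPolynomial (Fin n) ℝ} (hQ : Q ∈ I ^ (m + 1)) : dirDeriv w Q ∈ I ^ m := by
  induction m generalizing Q with
  | zero => simp
  | succ m ih =>
    rw [pow_succ] at hQ
    refine Submodule.mul_induction_on hQ (fun a ha b hb => ?_) fun a b ha hb => ?_
    · rw [Derivation.leibniz, smul_eq_mul, smul_eq_mul]
      refine Ideal.add_mem _ (Ideal.mul_mem_right _ _ ha) ?_
      rw [mul_comm, pow_succ]
      exact Ideal.mul_mem_mul (ih ha) hb
    · rw [map_add]
      exact Ideal.add_mem _ ha hb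

theorem vanishesTo_of_mem_faceIdeal (hT : IsSimplex T) (hf : f ⊆ T) {m : ℕ}
    {Q : MvPolynomial (Fin n) ℝ} (hQ : Q ∈ faceIdeal T f ^ (m + 1)) : VanishesTo (hull f) m Q := by
  have h0 : ∀ {m Q}, Q ∈ faceIdeal T f ^ (m + 1) → ∀ x ∈ hull f, polyFun Q x = 0 := by
    intro m Q hQ x hx
    have hle : faceIdeal T f ≤
        RingHom.ker (MvPolynomial.aeval (R := ℝ) (fun i => x i) : MvPolynomial (Fin n) ℝ →ₐ[ℝ] ℝ) := by
      refine Ideal.span_le.2 ?_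
      rintro _ ⟨v, hv, hvf, rfl⟩
      exact (polyFun_baryPoly T v x).trans (((mem_hull_iff hT hf).1 hx).2 v hv hvf)
    exact hle (Ideal.pow_le_self (Nat.succ_ne_zero m) hQ)
  induction m generalizing Q with
  | zero => exact h0 hQ
  | succ m ih => exact ⟨h0 hQ, fun w => ih (dirDeriv_mem_pow _ w hQ)⟩

theorem bernPoly_mem_faceIdeal (hf : f ⊆ T) (α : E n →₀ ℕ) :
    bernPoly T α ∈ faceIdeal T f ^ dist T f α := by
  classical
  rw [bernPoly, prod_eq_prod_mul_prod_sdiff hf (fun _ _ _ => rfl), dist,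
    ← Finset.prod_pow_eq_pow_sum]
  refine Ideal.mul_mem_left _ _ (Ideal.prod_mem_prod fun v hv => Ideal.pow_mem_pow ?_ _)
  obtain ⟨h1, h2⟩ : v ∈ T ∧ v ∉ f := by simpa using hv
  exact Ideal.subset_span ⟨v, h1, h2, rfl⟩

/-- Polynomials on two simplices with the same degrees of freedom on a common sub-simplex have the
same derivatives on it. -/
theorem vanishesTo_sub (hrn : r n = 0) (hT : IsSimplex T) (hT' : IsSimplex T')
    (hν : ∀ f ∈ subsimplices T, 1 ≤ dim f → dim f < n → IsNormalFrame f (ν f))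
    (hf : f ⊆ T) (hf' : f ⊆ T') (hne : f.Nonempty) (hfT : ¬ T ⊆ f)
    {P P' : MvPolynomial (Fin n) ℝ} (hP : polyFun P ∈ poly n k) (hP' : polyFun P' ∈ poly n k)
    (h : ∀ d ∈ localDoFs k r T ∩ localDoFs k r T',
      dofValue ν T (polyFun P) d = dofValue ν T' (polyFun P') d) {m : ℕ} (hm : m ≤ r (dim f)) :
    VanishesTo (hull f) m (P - P') := by
  have hsub : polyFun (P - P') = polyFun P - polyFun P' := funext (polyFun_sub P P')
  obtain ⟨c, hc⟩ := exists_bernSum hT (u := polyFun (P - P'))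
    (by rw [hsub]; exact Submodule.sub_mem _ hP hP')
  have h0 := coeff_eq_zero_of_dofs (k := k) hrn hT hν c ⟨hne, hf⟩ fun d hd hdf => by
    obtain ⟨φ, hφ⟩ := exists_dofFunctional ν hT hd
    rw [hc, hφ _ (P - P') fun _ _ => rfl, map_sub, ← hφ (polyFun P) P fun _ _ => rfl,
      ← hφ (polyFun P') P' fun _ _ => rfl,
      h d ⟨hd, mem_localDoFs_of_carrier_subset hT' hf' hfT hd hdf⟩,
      dofValue_eq_of_carrier_subset hT hT' hf hf' hfT hd hdf, sub_self]
  refine vanishesTo_of_mem_faceIdeal hT hf ?_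
  rw [← polyFun_injective hc, bernSum]
  refine Ideal.sum_mem _ fun α hα => ?_
  -- Near nodes have zero coefficient; a far one contributes at least r_{dim f} + 1 ≥ m + 1 factors
  -- from the ideal.
  by_cases hd : dist T f α ≤ r (dim f)
  · rw [h0 α ⟨mem_nodes.1 hα, hd⟩, zero_smul]
    exact Ideal.zero_mem _
  · rw [MvPolynomial.smul_eq_C_mul]
    refine Ideal.mul_mem_left _ _ (Ideal.pow_le_pow_right ?_ (bernPoly_mem_faceIdeal hf α))
    omega

end

section

variable {n : ℕ}

/-! ### Piecewise polynomial functions on a mesh -/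

/-- The cells are finitely many and closed, so those not containing x impose nothing near x. -/
theorem hasFDerivWithinAt_of_cover {Th : Finset (Finset (E n))} {Ω : Set (E n)}
    (hcov : Ω ⊆ ⋃ T ∈ Th, hull T) {u : E n → ℝ} {x : E n} {L : E n →L[ℝ] ℝ}
    (h : ∀ T ∈ Th, x ∈ hull T → HasFDerivWithinAt u L (hull T ∩ Ω) x) :
    HasFDerivWithinAt u L Ω x := by
  classical
  have key : ∀ S ⊆ Th, HasFDerivWithinAt u L (⋃ T ∈ S, hull T ∩ Ω) x := fun S => by
    induction S using Finset.induction_on with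
    | empty => intro _; simp [HasFDerivWithinAt.empty]
    | insert T S hTS ih =>
      intro hS
      rw [Finset.set_biUnion_insert]
      refine HasFDerivWithinAt.union ?_ (ih fun T' hT' => hS (Finset.mem_insert_of_mem hT'))
      by_cases hx : x ∈ hull T
      · exact h T (hS (Finset.mem_insert_self T S)) hx
      · refine HasFDerivWithinAt.of_notMem_closure fun hx' => hx ?_
        exact (isCompact_hull T).isClosed.closure_subset_iff.2 Set.inter_subset_left hx'
  refine (key Th subset_rfl).mono fun y hy => ?_
  obtain ⟨T, hT, hyT⟩ := Set.mem_iUnion₂.1 (hcov hy)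
  exact Set.mem_iUnion₂.2 ⟨T, hT, hyT, hy⟩

theorem continuousWithinAt_of_cover {Th : Finset (Finset (E n))} {Ω : Set (E n)}
    (hcov : Ω ⊆ ⋃ T ∈ Th, hull T) {u : E n → ℝ} {x : E n}
    (h : ∀ T ∈ Th, x ∈ hull T → ContinuousWithinAt u (hull T ∩ Ω) x) :
    ContinuousWithinAt u Ω x := by
  classical
  have key : ∀ S ⊆ Th, ContinuousWithinAt u (⋃ T ∈ S, hull T ∩ Ω) x := fun S => by
    induction S using Finset.induction_on with
    | empty => intro _; simp [ContinuousWithinAt]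
    | insert T S hTS ih =>
      intro hS
      rw [Finset.set_biUnion_insert]
      refine ContinuousWithinAt.union ?_ (ih fun T' hT' => hS (Finset.mem_insert_of_mem hT'))
      by_cases hx : x ∈ hull T
      · exact h T (hS (Finset.mem_insert_self T S)) hx
      · refine continuousWithinAt_of_notMem_closure fun hx' => hx ?_
        exact (isCompact_hull T).isClosed.closure_subset_iff.2 Set.inter_subset_left hx'
  refine (key Th subset_rfl).mono fun y hy => ?_
  obtain ⟨T, hT, hyT⟩ := Set.mem_iUnion₂.1 (hcov hy)
  exact Set.mem_iUnion₂.2 ⟨T, hT, hyT, hy⟩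

/-- Polynomials on the cells whose derivatives agree on the intersections of cells form a smooth
function. -/
theorem contDiffOn_of_piecewise {Th : Finset (Finset (E n))} {Ω : Set (E n)} (hΩ : IsOpen Ω)
    (hcov : Ω ⊆ ⋃ T ∈ Th, hull T) {m : ℕ} {P : Finset (E n) → MvPolynomial (Fin n) ℝ}
    (hP : ∀ T ∈ Th, ∀ T' ∈ Th, VanishesTo (hull T ∩ hull T') m (P T - P T')) {u : E n → ℝ}
    (hu : ∀ T ∈ Th, Set.EqOn u (polyFun (P T)) (hull T ∩ Ω)) : ContDiffOn ℝ m u Ω := by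
  induction m generalizing P u with
  | zero =>
    rw [Nat.cast_zero, contDiffOn_zero]
    intro x hx
    refine continuousWithinAt_of_cover hcov fun T hT hxT => ?_
    exact (continuous_polyFun (P T)).continuousWithinAt.congr (fun y hy => hu T hT hy)
      (hu T hT ⟨hxT, hx⟩)
  | succ m ih =>
    have hder : ∀ T ∈ Th, ∀ x ∈ hull T ∩ Ω, ∃ L : E n →L[ℝ] ℝ, HasFDerivWithinAt u L Ω x ∧
        ∀ w, L w = polyFun (dirDeriv w (P T)) x := by
      rintro T hT x ⟨hxT, hx⟩
      obtain ⟨L, hL, hL'⟩ := hasFDerivAt_polyFun (P T) x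
      refine ⟨L, hasFDerivWithinAt_of_cover hcov fun T' hT' hxT' => ?_, hL'⟩
      obtain ⟨M, hM, hM'⟩ := hasFDerivAt_polyFun (P T') x
      -- First derivatives agree on common points of two cells, so one linear map serves all cells
      -- through x; the directional derivatives of u are then again piecewise polynomial and the
      -- induction applies to them.
      have hLM : L = M := ContinuousLinearMap.ext fun w => by
        have := ((hP T hT T' hT').2 w).eq_zero x ⟨hxT, hxT'⟩
        rw [map_sub, polyFun_sub, sub_eq_zero] at this
        rw [hL', hM', this]
      rw [hLM]
      exact hM.hasFDerivWithinAt.congr (fun y hy => hu T' hT' hy) (hu T' hT' ⟨hxT', hx⟩)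
    rw [Nat.cast_succ, contDiffOn_succ_iff_fderiv_apply hΩ.uniqueDiffOn]
    refine ⟨fun x hx => ?_, fun h => ?_, fun w => ?_⟩
    · obtain ⟨T, hT, hxT⟩ := Set.mem_iUnion₂.1 (hcov hx)
      obtain ⟨L, hL, -⟩ := hder T hT x ⟨hxT, hx⟩
      exact hL.differentiableWithinAt
    · exact absurd h (by simp)
    · refine ih (P := fun T => dirDeriv w (P T)) (fun T hT T' hT' => ?_) fun T hT x hx => ?_
      · rw [← map_sub]
        exact (hP T hT T' hT').2 w
      · obtain ⟨L, hL, hL'⟩ := hder T hT x hx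
        simp only [hL.fderivWithin (hΩ.uniqueDiffOn x hx.2), hL']

/-! ### The finite element space on a mesh -/

variable {k m : ℕ} {r : ℕ → ℕ} {ν : (f : Finset (E n)) → Fin (n + 1 - f.card) → E n}
  {Th : Finset (Finset (E n))} {Ω : Set (E n)}

theorem vanishesTo_sub_of_isMesh (hrn : r n = 0) (hrm : r (n - 1) = m)
    (hr : ∀ ℓ, ℓ + 2 ≤ n → 2 * r (ℓ + 1) ≤ r ℓ) (hM : IsMesh Th Ω)
    (hν : ∀ T ∈ Th, ∀ f ∈ subsimplices T, 1 ≤ dim f → dim f < n → IsNormalFrame f (ν f))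
    {P : Finset (E n) → MvPolynomial (Fin n) ℝ} (hP : ∀ T ∈ Th, polyFun (P T) ∈ poly n k)
    (h : ∀ T ∈ Th, ∀ T' ∈ Th, ∀ d ∈ localDoFs k r T ∩ localDoFs k r T',
      dofValue ν T (polyFun (P T)) d = dofValue ν T' (polyFun (P T')) d) :
    ∀ T ∈ Th, ∀ T' ∈ Th, VanishesTo (hull T ∩ hull T') m (P T - P T') := by
  classical
  intro T hT T' hT'
  have hST := hM.simplex T hT
  have hST' := hM.simplex T' hT'
  by_cases hTT' : T = T'
  · rw [hTT', sub_self]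
    exact vanishesTo_zero _ _
  have hinter : hull T ∩ hull T' = hull (T ∩ T') := by
    rw [hM.conforming T hT T' hT', hull, Finset.coe_inter]
  rw [hinter]
  have hTf : ¬ T ⊆ T ∩ T' := fun hs => hTT' (Finset.eq_of_subset_of_card_le
    (hs.trans Finset.inter_subset_right) (by rw [hST.2, hST'.2]))
  rcases (T ∩ T').eq_empty_or_nonempty with he | hne
  · rw [he]
    have : hull (∅ : Finset (E n)) = ∅ := by simp [hull]
    rw [this]
    exact vanishesTo_empty m _
  · refine vanishesTo_sub hrn hST hST' (hν T hT) Finset.inter_subset_left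
      Finset.inter_subset_right hne hTf (hP T hT) (hP T' hT') (h T hT T' hT') ?_
    -- Distinct cells meet in dimension at most n - 1, where r is at least r_{n-1} = m.
    have hd := dim_lt hST.2 (f := T ∩ T') ⟨hne, Finset.inter_subset_left⟩ fun h => hTf h.ge
    rw [← hrm]
    exact monotone_bound hrn hr (by omega) (Nat.sub_le n 1)

theorem existsUnique_feSpace (hrn : r n = 0) (hrm : r (n - 1) = m)
    (hr : ∀ ℓ, ℓ + 2 ≤ n → 2 * r (ℓ + 1) ≤ r ℓ) (hM : IsMesh Th Ω)
    (hν : ∀ T ∈ Th, ∀ f ∈ subsimplices T, 1 ≤ dim f → dim f < n → IsNormalFrame f (ν f))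
    (p : Finset (E n) → E n → ℝ) (hp : ∀ T ∈ Th, p T ∈ poly n k)
    (h : ∀ T ∈ Th, ∀ T' ∈ Th, ∀ d ∈ localDoFs k r T ∩ localDoFs k r T',
      dofValue ν T (p T) d = dofValue ν T' (p T') d) :
    ∃! u, u ∈ feSpace m k r ν Th Ω ∧ ∀ T ∈ Th, Set.EqOn u (p T) (hull T) := by
  classical
  have hex : ∀ T, ∃ Q : MvPolynomial (Fin n) ℝ, T ∈ Th → polyFun Q = p T := fun T => by
    by_cases hT : T ∈ Th
    · obtain ⟨Q, -, hQ⟩ := mem_poly.1 (hp T hT)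
      exact ⟨Q, fun _ => hQ⟩
    · exact ⟨0, fun h => absurd h hT⟩
  choose P hP using hex
  have hvan := vanishesTo_sub_of_isMesh (P := P) (k := k) (m := m) hrn hrm hr hM hν
    (fun T hT => by rw [hP T hT]; exact hp T hT)
    fun T hT T' hT' d hd => by rw [hP T hT, hP T' hT']; exact h T hT T' hT' d hd
  -- The choice of a cell is immaterial: by vanishing of order zero, the polynomials agree on common
  -- points.
  let u : E n → ℝ := fun x => if hx : ∃ T ∈ Th, x ∈ hull T then p hx.choose x else 0
  have hu : ∀ T ∈ Th, Set.EqOn u (p T) (hull T) := fun T hT x hx => by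
    have hx' : ∃ T ∈ Th, x ∈ hull T := ⟨T, hT, hx⟩
    obtain ⟨hT', hxT'⟩ := hx'.choose_spec
    have h1 := (hvan _ hT' T hT).eq_zero x ⟨hxT', hx⟩
    rw [polyFun_sub, sub_eq_zero, hP _ hT', hP T hT] at h1
    simp only [u, dif_pos hx', h1]
  have hcl : ∀ x, x ∈ closure Ω ↔ ∃ T ∈ Th, x ∈ hull T := fun x => by
    rw [hM.closure_eq, Set.mem_iUnion₂]
    simp only [exists_prop]
  refine ⟨u, ⟨⟨fun x hx => ?_, ?_, fun T hT => ⟨p T, hp T hT, hu T hT⟩, ?_⟩, hu⟩, ?_⟩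
  · rw [hcl] at hx
    exact dif_neg hx
  · refine contDiffOn_of_piecewise hM.isOpen (hM.closure_eq ▸ subset_closure) hvan
      fun T hT x hx => ?_
    rw [hu T hT hx.1, hP T hT]
  · intro T hT T' hT' d hd
    obtain ⟨φ, hφ⟩ := exists_dofFunctional ν (hM.simplex T hT) hd.1
    obtain ⟨φ', hφ'⟩ := exists_dofFunctional ν (hM.simplex T' hT') hd.2
    have h1 := h T hT T' hT' d hd
    rw [← hP T hT, ← hP T' hT', hφ _ (P T) fun _ _ => rfl, hφ' _ (P T') fun _ _ => rfl] at h1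
    rw [hφ u (P T) (by rw [hP T hT]; exact hu T hT),
      hφ' u (P T') (by rw [hP T' hT']; exact hu T' hT'), h1]
  · rintro v ⟨hv, hv'⟩
    funext x
    by_cases hx : ∃ T ∈ Th, x ∈ hull T
    · obtain ⟨T, hT, hxT⟩ := hx
      rw [hv' T hT hxT, hu T hT hxT]
    · rw [hv.1 x (by rwa [hcl]), show u x = 0 from dif_neg hx]

theorem exists_polyFun_of_mem_feSpace {u : E n → ℝ} (hu : u ∈ feSpace m k r ν Th Ω)
    {T : Finset (E n)} (hT : T ∈ Th) :
    ∃ Q : MvPolynomial (Fin n) ℝ, polyFun Q ∈ poly n k ∧ Set.EqOn u (polyFun Q) (hull T) := by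
  obtain ⟨p, hp, hup⟩ := hu.2.2.1 T hT
  obtain ⟨Q, -, rfl⟩ := mem_poly.1 hp
  exact ⟨Q, hp, hup⟩

/-- The finite element space as a linear space. -/
noncomputable def feSubmodule (hM : IsMesh Th Ω) (m k : ℕ) (r : ℕ → ℕ)
    (ν : (f : Finset (E n)) → Fin (n + 1 - f.card) → E n) : Submodule ℝ (E n → ℝ) where
  carrier := feSpace m k r ν Th Ω
  zero_mem' := by
    refine ⟨fun _ _ => rfl, contDiffOn_const, fun T _ => ⟨0, Submodule.zero_mem _, fun _ _ => rfl⟩,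
      fun T hT T' hT' d hd => ?_⟩
    obtain ⟨φ, hφ⟩ := exists_dofFunctional ν (hM.simplex T hT) hd.1
    obtain ⟨φ', hφ'⟩ := exists_dofFunctional ν (hM.simplex T' hT') hd.2
    rw [hφ 0 0 fun x _ => (polyFun_zero x).symm, hφ' 0 0 fun x _ => (polyFun_zero x).symm,
      map_zero, map_zero]
  add_mem' := by
    intro u v hu hv
    refine ⟨fun x hx => by rw [Pi.add_apply, hu.1 x hx, hv.1 x hx, add_zero], hu.2.1.add hv.2.1,
      fun T hT => ?_, fun T hT T' hT' d hd => ?_⟩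
    · obtain ⟨p, hp, hup⟩ := hu.2.2.1 T hT
      obtain ⟨q, hq, hvq⟩ := hv.2.2.1 T hT
      exact ⟨p + q, Submodule.add_mem _ hp hq, fun x hx => by
        rw [Pi.add_apply, Pi.add_apply, hup hx, hvq hx]⟩
    · obtain ⟨P, -, hP⟩ := exists_polyFun_of_mem_feSpace hu hT
      obtain ⟨Q, -, hQ⟩ := exists_polyFun_of_mem_feSpace hv hT
      obtain ⟨P', -, hP'⟩ := exists_polyFun_of_mem_feSpace hu hT'
      obtain ⟨Q', -, hQ'⟩ := exists_polyFun_of_mem_feSpace hv hT'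
      rw [dofValue_add (hM.simplex T hT) hd.1 hP hQ, dofValue_add (hM.simplex T' hT') hd.2 hP' hQ',
        hu.2.2.2 T hT T' hT' d hd, hv.2.2.2 T hT T' hT' d hd]
  smul_mem' := by
    intro c u hu
    refine ⟨fun x hx => by rw [Pi.smul_apply, hu.1 x hx, smul_zero], hu.2.1.const_smul c,
      fun T hT => ?_, fun T hT T' hT' d hd => ?_⟩
    · obtain ⟨p, hp, hup⟩ := hu.2.2.1 T hT
      exact ⟨c • p, Submodule.smul_mem _ c hp, fun x hx => by
        rw [Pi.smul_apply, Pi.smul_apply, hup hx]⟩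
    · obtain ⟨P, -, hP⟩ := exists_polyFun_of_mem_feSpace hu hT
      obtain ⟨P', -, hP'⟩ := exists_polyFun_of_mem_feSpace hu hT'
      rw [dofValue_smul (hM.simplex T hT) hd.1 hP, dofValue_smul (hM.simplex T' hT') hd.2 hP',
        hu.2.2.2 T hT T' hT' d hd]

/-- Injectivity holds cell by cell. For surjectivity, solve on each cell and glue: prescribing one
value for each shared DoF makes the family single-valued, so conformity applies. -/
theorem global_unisolvence (hn : 1 ≤ n) (hrn : r n = 0) (hrm : r (n - 1) = m)
    (hr : ∀ ℓ, ℓ + 2 ≤ n → 2 * r (ℓ + 1) ≤ r ℓ) (hk : 2 * r 0 + 1 ≤ k) (hM : IsMesh Th Ω)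
    (hν : ∀ T ∈ Th, ∀ f ∈ subsimplices T, 1 ≤ dim f → dim f < n → IsNormalFrame f (ν f)) :
    ∃ Φ : feSubmodule hM m k r ν ≃ₗ[ℝ] (globalDoFs k r Th → ℝ),
      ∀ (u : feSubmodule hM m k r ν) (d : globalDoFs k r Th), ∀ T ∈ Th,
        (d : DoF n) ∈ localDoFs k r T → Φ u d = dofValue ν T u d := by
  classical
  -- `t d` is some cell on which to evaluate `d`; single-valuedness makes the result independent of
  -- this choice.
  choose! t ht using fun (d : DoF n) (hd : d ∈ globalDoFs k r Th) => hd
  let Ψ : feSubmodule hM m k r ν →ₗ[ℝ] (globalDoFs k r Th → ℝ) :=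
    { toFun := fun u d => dofValue ν (t d) u d
      map_add' := fun u v => funext fun d => by
        obtain ⟨P, -, hP⟩ := exists_polyFun_of_mem_feSpace u.2 (ht d d.2).1
        obtain ⟨Q, -, hQ⟩ := exists_polyFun_of_mem_feSpace v.2 (ht d d.2).1
        exact dofValue_add (hM.simplex _ (ht d d.2).1) (ht d d.2).2 hP hQ
      map_smul' := fun c u => funext fun d => by
        obtain ⟨P, -, hP⟩ := exists_polyFun_of_mem_feSpace u.2 (ht d d.2).1
        exact dofValue_smul (hM.simplex _ (ht d d.2).1) (ht d d.2).2 hP c }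
  have hΨ : ∀ (u : feSubmodule hM m k r ν) (d : globalDoFs k r Th), ∀ T ∈ Th,
      (d : DoF n) ∈ localDoFs k r T → Ψ u d = dofValue ν T u d := fun u d T hT hd =>
    u.2.2.2.2 (t d) (ht d d.2).1 T hT d ⟨(ht d d.2).2, hd⟩
  have hΦ : ∀ T, ∃ Φ : poly n k → (localDoFs k r T → ℝ), T ∈ Th → Function.Bijective Φ ∧
      ∀ u d, Φ u d = dofValue ν T u d := fun T => by
    by_cases hT : T ∈ Th
    · obtain ⟨Φ, h⟩ := unisolvence hn hrn hr hk (hM.simplex T hT) (hν T hT)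
      exact ⟨Φ, fun _ => ⟨Φ.bijective, h⟩⟩
    · exact ⟨0, fun h => absurd h hT⟩
  choose Φ hΦ using hΦ
  have hinj : Function.Injective Ψ := by
    rw [← LinearMap.ker_eq_bot, LinearMap.ker_eq_bot']
    intro u hu
    refine Subtype.ext (funext fun x => ?_)
    change (u : E n → ℝ) x = 0
    by_cases hx : x ∈ closure Ω
    · rw [hM.closure_eq] at hx
      obtain ⟨T, hT, hxT⟩ := Set.mem_iUnion₂.1 hx
      obtain ⟨Q, hQ, huQ⟩ := exists_polyFun_of_mem_feSpace u.2 hT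
      have h0 : (⟨polyFun Q, hQ⟩ : poly n k) = 0 := (hΦ T hT).1.1 <| funext fun d => by
        obtain ⟨φ, hφ⟩ := exists_dofFunctional ν (hM.simplex T hT) d.2
        have h1 := hΨ u ⟨d, T, hT, d.2⟩ T hT d.2
        have h2 : dofValue ν T ((0 : poly n k) : E n → ℝ) d = φ 0 :=
          hφ _ 0 fun x _ => (polyFun_zero x).symm
        rw [hu, hφ _ Q huQ] at h1
        rw [(hΦ T hT).2, (hΦ T hT).2, hφ _ Q fun _ _ => rfl, h2, map_zero]
        exact h1.symm
      rw [huQ hxT]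
      exact congrFun (congrArg Subtype.val h0) x
    · exact u.2.1 x hx
  have hsurj : Function.Surjective Ψ := fun y => by
    have hex : ∀ T, ∃ p : poly n k, T ∈ Th → ∀ d (hd : d ∈ localDoFs k r T) (hT : T ∈ Th),
        dofValue ν T p d = y ⟨d, T, hT, hd⟩ := fun T => by
      by_cases hT : T ∈ Th
      · obtain ⟨p, hp⟩ := (hΦ T hT).1.2 fun d => y ⟨d, T, hT, d.2⟩
        refine ⟨p, fun _ d hd _ => ?_⟩
        rw [← (hΦ T hT).2 p ⟨d, hd⟩, hp]
      · exact ⟨0, fun h => absurd h hT⟩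
    choose p hp using hex
    obtain ⟨u, ⟨hu, hup⟩, -⟩ := existsUnique_feSpace hrn hrm hr hM hν (k := k)
      (fun T => (p T : E n → ℝ)) (fun T _ => (p T).2) fun T hT T' hT' d hd => by
        rw [hp T hT d hd.1 hT, hp T' hT' d hd.2 hT']
    refine ⟨⟨u, hu⟩, funext fun d => ?_⟩
    obtain ⟨T, hT, hd⟩ := d.2
    obtain ⟨Q, -, hQ⟩ := mem_poly.1 (p T).2
    obtain ⟨φ, hφ⟩ := exists_dofFunctional ν (hM.simplex T hT) hd
    rw [hΨ _ d T hT hd, ← hp T hT d hd hT, hφ _ Q (by rw [hQ]; exact hup T hT),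
      hφ _ Q fun _ _ => by rw [hQ]]
  exact ⟨LinearEquiv.ofBijective Ψ ⟨hinj, hsurj⟩, hΨ⟩

end

end SmoothFE

/-! ### The main theorem -/

theorem mainTheorem11 (n m k : ℕ) (hn : 1 ≤ n) (r : ℕ → ℕ) (hrn : r n = 0) (hrm : r (n - 1) = m)
    (hr : ∀ ℓ, ℓ + 2 ≤ n → 2 * r (ℓ + 1) ≤ r ℓ) (hk : 2 * r 0 + 1 ≤ k) :
    -- direct decompositions of the simplicial lattice and of the polynomial space
    (∀ T : Finset (EuclideanSpace ℝ (Fin n)), SmoothFE.IsSimplex T →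
      (SmoothFE.subsimplices T).PairwiseDisjoint (SmoothFE.piece k r T) ∧
      (⋃ f ∈ SmoothFE.subsimplices T, SmoothFE.piece k r T f) = SmoothFE.lattice k T ∧
      iSupIndep (fun f : SmoothFE.subsimplices T =>
        SmoothFE.polySpan T (SmoothFE.piece k r T f)) ∧
      (⨆ f : SmoothFE.subsimplices T, SmoothFE.polySpan T (SmoothFE.piece k r T f))
        = SmoothFE.poly n k) ∧
    -- unisolvence on one simplex, for every choice of normal frames
    (∀ (T : Finset (EuclideanSpace ℝ (Fin n)))
      (ν : (f : Finset (EuclideanSpace ℝ (Fin n))) →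
        Fin (n + 1 - f.card) → EuclideanSpace ℝ (Fin n)),
      SmoothFE.IsSimplex T →
      (∀ f ∈ SmoothFE.subsimplices T, 1 ≤ SmoothFE.dim f → SmoothFE.dim f < n →
        SmoothFE.IsNormalFrame f (ν f)) →
      ∃ Φ : SmoothFE.poly n k ≃ₗ[ℝ] (SmoothFE.localDoFs k r T → ℝ),
        ∀ (u : SmoothFE.poly n k) (d : SmoothFE.localDoFs k r T),
          Φ u d = SmoothFE.dofValue ν T u d) ∧
    -- the global space on a conforming simplicial mesh, with one normal frame per sub-simplex
    (∀ (Th : Finset (Finset (EuclideanSpace ℝ (Fin n)))) (Ω : Set (EuclideanSpace ℝ (Fin n)))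
      (ν : (f : Finset (EuclideanSpace ℝ (Fin n))) →
        Fin (n + 1 - f.card) → EuclideanSpace ℝ (Fin n)),
      SmoothFE.IsMesh Th Ω →
      (∀ T ∈ Th, ∀ f ∈ SmoothFE.subsimplices T, 1 ≤ SmoothFE.dim f → SmoothFE.dim f < n →
        SmoothFE.IsNormalFrame f (ν f)) →
      -- piecewise polynomials with single-valued degrees of freedom are `C^m`-conforming
      (∀ p : Finset (EuclideanSpace ℝ (Fin n)) → EuclideanSpace ℝ (Fin n) → ℝ,
        (∀ T ∈ Th, p T ∈ SmoothFE.poly n k) →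
        (∀ T ∈ Th, ∀ T' ∈ Th, ∀ d ∈ SmoothFE.localDoFs k r T ∩ SmoothFE.localDoFs k r T',
          SmoothFE.dofValue ν T (p T) d = SmoothFE.dofValue ν T' (p T') d) →
        ∃! u, u ∈ SmoothFE.feSpace m k r ν Th Ω ∧ ∀ T ∈ Th, Set.EqOn u (p T) (SmoothFE.hull T)) ∧
      -- the degrees of freedom of the mesh are unisolvent for `V_h`
      ∃ V : Submodule ℝ (EuclideanSpace ℝ (Fin n) → ℝ),
        (V : Set (EuclideanSpace ℝ (Fin n) → ℝ)) = SmoothFE.feSpace m k r ν Th Ω ∧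
        ∃ Φ : V ≃ₗ[ℝ] (SmoothFE.globalDoFs k r Th → ℝ),
          ∀ (u : V) (d : SmoothFE.globalDoFs k r Th), ∀ T ∈ Th, (d : SmoothFE.DoF n) ∈
            SmoothFE.localDoFs k r T → Φ u d = SmoothFE.dofValue ν T u d) := by
  refine ⟨fun T hT => SmoothFE.decomposition hrn hr hk hT, fun T ν hT hν =>
    SmoothFE.unisolvence hn hrn hr hk hT hν, fun Th Ω ν hM hν => ⟨fun p hp h =>
    SmoothFE.existsUnique_feSpace hrn hrm hr hM hν p hp h, SmoothFE.feSubmodule hM m k r ν, rfl,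
    SmoothFE.global_unisolvence hn hrn hrm hr hk hM hν⟩⟩
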